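/- Let $a\in(\frac12,\frac23]$, $p\in(0,1)$, $q=1-p$. Consider the chain $X_{n+1}=aX_n+\xi_{n+1}$ on $[0,\frac1{1-a}]$ with i.i.d. innovations, $\mathbb P(\xi_n=1)=p$, $\mathbb P(\xi_n=-1)=q$, killed at $\tau=\inf\{n\ge0:X_n<0\}$; its transition operator acts on functions on $[0,\frac1{1-a}]$ by $Pf(x)=\mathbb E_x[f(X_1);\tau>1]$. Let $T(x)=\frac1a(x+1)$ for $0\le x\le\frac{2a-1}{1-a}$, $x\neq 1$, and $T(x)=\frac1a(x-1)$ for $1\le x\le\frac1{1-a}$. Let $\varkappa=\inf\{k\ge0:T^k(0)\in(\frac{2a-1}{1-a},1)\}\in\mathbb N\cup\{\infty\}$ and $\varkappa'=\#\{T^k(0):0\le k<\varkappa+1\}-1$. The orbit of $0$ is called aperiodic if $\varkappa=\varkappa'$, and eventually periodic if $\varkappa'<\infty=\varkappa$. Put $\delta_k=\mathbb 1\{T^k(0)<1\}$, $L_k=\sum_{i<k}\delta_i$, $c_k=q\delta_k+p(1-\delta_k)$. Let $U$ be the space of functions $f(x)=\sum_{k=0}^{\varkappa}u_k\mathbb 1\{x\ge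 T^k(0)\}$ on $[0,\frac1{1-a}]$ with $u_k\in\mathbb R$, $\sum_{k=0}^{\varkappa}|u_k|<\infty$, normed by $\|f\|=|f(0)|+\mathrm{Var}(f)$, where $\mathrm{Var}$ is the total variation on $[0,\frac1{1-a}]$, and let $(Mf)_k=f(T^k(0))-f(T^k(0)-)$ for $0\le k<\varkappa'+1$, with $f(0-)=0$. On $\mathbb R^{\varkappa'+1}$ (which means $\ell_1$ if $\varkappa'=\infty$), with the norm $\|\cdot\|_1$, let $$(Au)_0=p\sum_{k=0}^{\varkappa'}\delta_ku_k,\qquad (Au)_k=c_{k-1}u_{k-1}\quad(1\le k<\varkappa'+1),$$ and, if the orbit is eventually periodic, let $(\hat Au)_k=(Au)_k+c_{\varkappa'}u_{\varkappa'}\mathbb 1\{k=k_0\}$, where $k_0$ is the smallest integer with $T^{k_0}(0)=T^{\varkappa'+1}(0)$. The equation $\sum_{k=0}^{\varkappa}\delta_k(p/\lambda)^{k+1}(q/p)^{L_k}=1$ has a unique positive solution $\lambda=\lambda_a$, and $\lambda_a>p$. The space $U$ is invariant under $P$, and $M$ is a linear bijective isometry of $U$ onto $(\mathbb R^{\varkappa'+1},\|\cdot\|_1)$.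 Put $$v_k=(p/\lambda_a)^k(q/p)^{L_k}\ (0\le k<\varkappa+1),\qquad v_k^*=\sum_{n=k}^{\varkappa}\delta_n(p/\lambda_a)^{n-k+1}(q/p)^{L_n-L_k}\ (0\le k<\varkappa'+1),$$ $V(x)=\sum_{k=0}^{\varkappa}v_k\mathbb 1\{T^k(0)\le x\}$ (all these sums converge), $(u,w)=\sum_k u_kw_k$. The vector $v^*$ is bounded. (i) If the orbit of $0$ is aperiodic, then $P|_U=M^{-1}AM$. The number $\lambda_a$ is the leading eigenvalue of $A$: it is an eigenvalue, and every other point of the complex spectrum of $A$ is strictly smaller than $\lambda_a$ in modulus. Moreover $v\in\ell_1$, and $v$ and $v^*$ are the eigenvectors, unique up to factors, of $A$ and of its adjoint $A^*$ on $\ell_\infty$ for $\lambda_a$; $(v,v^*)>0$; and there are constants $C_1>0$ and $\gamma\in(0,1)$ such that for all $u\in(\mathbb R^{\varkappa'+1},\|\cdot\|_1)$ and all integers $n\ge0$, $$\left\|\lambda_a^{-n}A^nu-\frac{(u,v^*)}{(v,v^*)}\,v\right\|_1\le C_1\gamma^n\|u\|_1 .$$ (ii) If the orbit of $0$ is eventually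 periodic, then $P|_U=M^{-1}\hat AM$. The matrix of $\hat A$ is irreducible provided that $T^k(0)\ne\frac1{1-a}$ for all $k\ge 0$. In any case $\lambda_a$ is the leading eigenvalue of $\hat A$ (in the same sense); $V\in U$; $MV$ and $v^*$ are the right and left eigenvectors of $\hat A$, unique up to factors, for $\lambda_a$; $(MV,v^*)>0$; and the bound in (i) holds with $A$ replaced by $\hat A$ and $v$ replaced by $MV$. -/

import Mathlib

open MeasureTheory Filter Topology
open scoped ENNReal

noncomputable section

namespace KilledAR

/-! ### The interval map and the orbit of zero -/

/-- The state space `[0, 1/(1-a)]` of the chain. -/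
abbrev State (a : ℝ) : Type := Set.Icc (0 : ℝ) (1 / (1 - a))

/-- The hole `I_a = ((2a-1)/(1-a), 1)` (empty for `a = 2/3`). -/
def hole (a : ℝ) : Set ℝ := Set.Ioo ((2 * a - 1) / (1 - a)) 1

/-- The map `T_a`: `(x+1)/a` on `[0, (2a-1)/(1-a)]` (without the point `1` if `a = 2/3`) and
`(x-1)/a` on `[1, 1/(1-a)]`. Its values on the hole are never used below. -/
def T (a x : ℝ) : ℝ := if x < 1 then (x + 1) / a else (x - 1) / a

/-- The orbit of zero, `T_a^k(0)`; meaningful for `k ≤ ϰ_a`. -/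
def orb (a : ℝ) (k : ℕ) : ℝ := (T a)^[k] 0

/-- `ϰ_a`, the first time at which the orbit of zero is in the hole (`⊤` if never). -/
def kap (a : ℝ) : ℕ∞ := ⨅ (k : ℕ) (_ : orb a k ∈ hole a), (k : ℕ∞)

/-- `ϰ'_a`, the number of points of the orbit of zero, minus one. -/
def kap' (a : ℝ) : ℕ∞ := Set.encard {y : ℝ | ∃ k : ℕ, (k : ℕ∞) ≤ kap a ∧ y = orb a k} - 1

/-- `δ_k = 1{T_a^k(0) < 1}`. -/
def dlt (a : ℝ) (k : ℕ) : ℝ := if orb a k < 1 then 1 else 0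

/-- `L_k`, the number of `i < k` with `T_a^i(0) < 1`. -/
def occ (a : ℝ) (k : ℕ) : ℕ := ((Finset.range k).filter fun i => orb a i < 1).card

/-- `c_k = q δ_k + p (1 - δ_k)`, where `q = 1 - p`. -/
def cf (a p : ℝ) (k : ℕ) : ℝ := (1 - p) * dlt a k + p * (1 - dlt a k)

/-- `λ` solves `∑_{k=0}^{ϰ_a} δ_k (p/λ)^{k+1} (q/p)^{L_k} = 1` (with a convergent sum). -/
def CharEq (a p lam : ℝ) : Prop :=
  HasSum (fun k : {k : ℕ // (k : ℕ∞) ≤ kap a} =>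
    dlt a k * (p / lam) ^ (k.1 + 1) * ((1 - p) / p) ^ occ a k) 1

/-- The orbit of zero is aperiodic. -/
def Aperiodic (a : ℝ) : Prop := kap a = kap' a

/-- The orbit of zero is infinite in time but consists of finitely many points. -/
def EventuallyPeriodic (a : ℝ) : Prop := kap' a < ⊤ ∧ kap a = ⊤

/-! ### The killed transition operator -/

/-- Extension of a function on the state space by zero. -/
def extZero {a : ℝ} (f : State a → ℝ) (y : ℝ) : ℝ :=
  if h : y ∈ Set.Icc (0 : ℝ) (1 / (1 - a)) then f ⟨y, h⟩ else 0

/-- The law of an innovation: `1` with probability `p` and `-1` with probability `1 - p`. -/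
def innovation (p : ℝ) : Measure ℝ :=
  ENNReal.ofReal p • Measure.dirac 1 + ENNReal.ofReal (1 - p) • Measure.dirac (-1)

/-- `P f (x) = E_x [f(X_1); τ > 1]` where `X_1 = a x + ξ_1`. -/
def killedFun (a p : ℝ) (f : State a → ℝ) (x : State a) : ℝ :=
  ∫ ξ, extZero f (a * x.1 + ξ) ∂(innovation p)

theorem killedFun_apply (a p : ℝ) (f : State a → ℝ) (x : State a) :
    killedFun a p f x = (ENNReal.ofReal p).toReal * extZero f (a * x.1 + 1)
      + (ENNReal.ofReal (1 - p)).toReal * extZero f (a * x.1 - 1) := by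
  have h1 : ∀ (g : ℝ → ℝ) (y : ℝ) (c : ℝ),
      Integrable g (ENNReal.ofReal c • Measure.dirac y) := fun g y c =>
    (integrable_dirac (by simp)).smul_measure ENNReal.ofReal_ne_top
  rw [killedFun, innovation, integral_add_measure (h1 _ _ _) (h1 _ _ _),
    integral_smul_measure, integral_smul_measure, integral_dirac, integral_dirac]
  simp [sub_eq_add_neg]

theorem extZero_add {a : ℝ} (f g : State a → ℝ) (y : ℝ) : extZero (f + g) y = extZero f y + extZero g y := by
  unfold extZero; split_ifs <;> simp

theorem extZero_smul {a : ℝ} (c : ℝ) (f : State a → ℝ) (y : ℝ) : extZero (c • f) y = c * extZero f y := by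
  unfold extZero; split_ifs <;> simp

/-- The killed transition operator `P`. -/
def killed (a p : ℝ) : (State a → ℝ) →ₗ[ℝ] (State a → ℝ) where
  toFun := killedFun a p
  map_add' f g := by
    funext x; simp only [killedFun_apply, extZero_add, Pi.add_apply]; ring
  map_smul' c f := by
    funext x
    simp only [killedFun_apply, extZero_smul, Pi.smul_apply, smul_eq_mul, RingHom.id_apply]; ring

/-! ### Saltus functions that jump on the orbit of zero -/

theorem summable_step {a : ℝ} {u : {k : ℕ // (k : ℕ∞) ≤ kap a} → ℝ}
    (hu : Summable fun k => |u k|) (x : ℝ) :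
    Summable fun k : {k : ℕ // (k : ℕ∞) ≤ kap a} => u k * (if orb a k ≤ x then 1 else 0) := by
  refine Summable.of_norm_bounded hu fun k => ?_
  split_ifs <;> simp

/-- The space `U` of the functions `∑_{k=0}^{ϰ_a} u_k 1{x ≥ T_a^k(0)}` with `∑ |u_k| < ∞`. -/
def U (a : ℝ) : Submodule ℝ (State a → ℝ) where
  carrier := {f | ∃ u : {k : ℕ // (k : ℕ∞) ≤ kap a} → ℝ, (Summable fun k => |u k|) ∧
    ∀ x : State a, f x = ∑' k, u k * (if orb a k ≤ x.1 then 1 else 0)}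
  zero_mem' := ⟨0, by simp, by simp⟩
  add_mem' := by
    rintro f g ⟨u, hu, hf⟩ ⟨w, hw, hg⟩
    refine ⟨u + w, (hu.add hw).of_nonneg_of_le (fun k => abs_nonneg _)
      (fun k => abs_add_le _ _), fun x => ?_⟩
    simp only [Pi.add_apply, hf, hg, add_mul]
    rw [(summable_step hu _).tsum_add (summable_step hw _)]
  smul_mem' := by
    rintro c f ⟨u, hu, hf⟩
    refine ⟨c • u, by simpa [abs_mul] using hu.mul_left |c|, fun x => ?_⟩
    simp only [Pi.smul_apply, smul_eq_mul, hf, mul_assoc, tsum_mul_left]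

/-- `j = f(y) - f(y-)`, with the convention `f(0-) = 0`. -/
def IsJump {a : ℝ} (f : State a → ℝ) (y j : ℝ) : Prop :=
  Tendsto (extZero f) (𝓝[<] y) (𝓝 (extZero f y - j))

/-- The norm `|f(0)| + V[f]` of a function of bounded variation. -/
def bvNorm {a : ℝ} (f : State a → ℝ) : ℝ := |extZero f 0| + (eVariationOn f Set.univ).toReal

/-! ### Sequence spaces -/

/-- The indices `0 ≤ k ≤ ϰ'_a` (all natural numbers if `ϰ'_a = ∞`). -/
abbrev Idx (a : ℝ) : Type := {k : ℕ // (k : ℕ∞) ≤ kap' a}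

/-- `𝕜^{ϰ'_a + 1}` with the norm `‖·‖₁`; it is `ℓ₁` if `ϰ'_a = ∞`. -/
abbrev L1 (𝕜 : Type) [RCLike 𝕜] (a : ℝ) : Type := lp (fun _ : Idx a => 𝕜) 1

/-- `ℝ^{ϰ'_a + 1}` with the supremum norm; it is `ℓ_∞` if `ϰ'_a = ∞`. -/
abbrev Linf (a : ℝ) : Type := lp (fun _ : Idx a => ℝ) ∞

theorem L1.summable_norm {𝕜 : Type} [RCLike 𝕜] {a : ℝ} (u : L1 𝕜 a) :
    Summable fun k => ‖u k‖ := by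
  simpa using (lp.memℓp u).summable (by simp)

theorem L1.norm_eq {𝕜 : Type} [RCLike 𝕜] {a : ℝ} (u : L1 𝕜 a) : ‖u‖ = ∑' k, ‖u k‖ := by
  simp [lp.norm_eq_tsum_rpow (p := 1) (by simp) u]

theorem pair_summable {a : ℝ} (u : L1 ℝ a) (w : Linf a) : Summable fun k => u k * w k := by
  refine Summable.of_norm_bounded ((L1.summable_norm u).mul_right ‖w‖) fun k => ?_
  rw [norm_mul]
  exact mul_le_mul_of_nonneg_left (lp.norm_apply_le_norm (by simp) w k) (norm_nonneg _)

/-- The duality `(u, w) = ∑ u_k w_k`. -/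
def pair {a : ℝ} (u : L1 ℝ a) (w : Linf a) : ℝ := ∑' k, u k * w k

theorem abs_pair_le {a : ℝ} (u : L1 ℝ a) (w : Linf a) : |pair u w| ≤ ‖w‖ * ‖u‖ := by
  rw [L1.norm_eq, ← tsum_mul_left, ← Real.norm_eq_abs]
  refine tsum_of_norm_bounded ((L1.summable_norm u).mul_left ‖w‖).hasSum fun k => ?_
  rw [norm_mul, mul_comm]
  exact mul_le_mul_of_nonneg_right (lp.norm_apply_le_norm (by simp) w k) (norm_nonneg _)

/-- The functional `u ↦ (u, w)`. -/
def pairCLM {a : ℝ} (w : Linf a) : L1 ℝ a →L[ℝ] ℝ :=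
  LinearMap.mkContinuous
    { toFun := fun u => pair u w
      map_add' := fun u u' => by
        simp only [pair, lp.coeFn_add, Pi.add_apply, add_mul]
        exact (pair_summable u w).tsum_add (pair_summable u' w)
      map_smul' := fun c u => by
        simp only [pair, lp.coeFn_smul, Pi.smul_apply, smul_eq_mul, mul_assoc, tsum_mul_left,
          RingHom.id_apply] } ‖w‖ (fun u => abs_pair_le u w)

/-- The coordinate vector `e_k`. -/
def basisVec (𝕜 : Type) [RCLike 𝕜] {a : ℝ} (k : Idx a) : L1 𝕜 a := lp.single 1 k 1

theorem abs_pair_basis_le {a : ℝ} (B : L1 ℝ a →L[ℝ] L1 ℝ a) (w : Linf a) (k : Idx a) :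
    ‖pair (B (basisVec ℝ k)) w‖ ≤ ‖B‖ * ‖w‖ := by
  refine (abs_pair_le _ w).trans ?_
  rw [mul_comm]
  refine mul_le_mul_of_nonneg_right ((B.le_opNorm _).trans ?_) (norm_nonneg _)
  simp [basisVec]

/-- The adjoint on `ℓ_∞` of a bounded operator `B` on `ℓ₁`: `(B* w)_k = (B e_k, w)`. -/
def adj {a : ℝ} (B : L1 ℝ a →L[ℝ] L1 ℝ a) : Linf a →L[ℝ] Linf a :=
  LinearMap.mkContinuous
    { toFun := fun w => ⟨fun k => pair (B (basisVec ℝ k)) w,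
        memℓp_infty ⟨‖B‖ * ‖w‖, by rintro _ ⟨k, rfl⟩; exact abs_pair_basis_le B w k⟩⟩
      map_add' := fun w w' => by
        ext k
        simp only [pair, lp.coeFn_add, Pi.add_apply, mul_add]
        exact (pair_summable _ w).tsum_add (pair_summable _ w')
      map_smul' := fun c w => by
        ext k
        simp only [pair, lp.coeFn_smul, Pi.smul_apply, smul_eq_mul, RingHom.id_apply,
          ← tsum_mul_left]
        exact tsum_congr fun j => by ring } ‖B‖
    (fun w => lp.norm_le_of_forall_le (by positivity) fun k => abs_pair_basis_le B w k)

/-- The defining property of the adjoint. -/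
theorem pair_adj {a : ℝ} (B : L1 ℝ a →L[ℝ] L1 ℝ a) (u : L1 ℝ a) (w : Linf a) :
    pair (B u) w = pair u (adj B w) := by
  have h := (lp.hasSum_single (p := 1) (by simp) u).mapL ((pairCLM w).comp B)
  have h2 : ∀ k, ((pairCLM w).comp B) (lp.single 1 k (u k)) = u k * (adj B w) k := by
    intro k
    have : (lp.single 1 k (u k) : L1 ℝ a) = u k • basisVec ℝ k := by
      rw [basisVec, ← lp.single_smul]; simp
    rw [this, map_smul, smul_eq_mul]; rfl
  simp only [h2] at h
  exact h.tsum_eq.symm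

/-! ### The operators `A` and `Â` -/

/-- The index `k - 1` (used for `k ≥ 1` only). -/
def prevIdx {a : ℝ} (k : Idx a) : Idx a :=
  ⟨k.1 - 1, le_trans (by exact_mod_cast k.1.sub_le 1) k.2⟩

/-- The coordinates of `A u`: `(Au)_0 = p ∑ δ_k u_k` and `(Au)_k = c_{k-1} u_{k-1}`, `k ≥ 1`. -/
def opAFun {𝕜 : Type} [RCLike 𝕜] (a p : ℝ) (u : Idx a → 𝕜) (k : Idx a) : 𝕜 :=
  if k.1 = 0 then (p : 𝕜) * ∑' j : Idx a, (dlt a j : 𝕜) * u j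
  else (cf a p (k.1 - 1) : 𝕜) * u (prevIdx k)

theorem abs_dlt_le (a : ℝ) (k : ℕ) : |dlt a k| ≤ 1 := by
  unfold dlt; split_ifs <;> simp

theorem abs_cf_le (a p : ℝ) (k : ℕ) : |cf a p k| ≤ |1 - p| + |p| := by
  unfold cf dlt; split_ifs <;> simp

theorem norm_dlt_mul_le {𝕜 : Type} [RCLike 𝕜] {a : ℝ} (u : L1 𝕜 a) (k : Idx a) :
    ‖(dlt a k : 𝕜) * u k‖ ≤ ‖u k‖ := by
  rw [norm_mul, RCLike.norm_ofReal]
  exact mul_le_of_le_one_left (norm_nonneg _) (abs_dlt_le a k)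

theorem summable_dlt_mul {𝕜 : Type} [RCLike 𝕜] {a : ℝ} (u : L1 𝕜 a) :
    Summable fun k : Idx a => (dlt a k : 𝕜) * u k :=
  Summable.of_norm_bounded (L1.summable_norm u) (norm_dlt_mul_le u)

theorem sum_opAFun_le {𝕜 : Type} [RCLike 𝕜] {a : ℝ} (p : ℝ) (u : L1 𝕜 a) (s : Finset (Idx a)) :
    ∑ k ∈ s, ‖opAFun a p u k‖ ≤ (|p| + (|1 - p| + |p|)) * ‖u‖ := by
  rw [← Finset.sum_filter_add_sum_filter_not s (fun k => k.1 = 0), add_mul]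
  refine add_le_add ?_ ?_
  · have h1 : ∀ k ∈ s.filter (fun k => k.1 = 0), ‖opAFun a p u k‖ ≤ |p| * ‖u‖ := by
      intro k hk
      rw [opAFun, if_pos (Finset.mem_filter.1 hk).2, norm_mul, RCLike.norm_ofReal, L1.norm_eq]
      exact mul_le_mul_of_nonneg_left
        (tsum_of_norm_bounded (L1.summable_norm u).hasSum (norm_dlt_mul_le u)) (abs_nonneg _)
    have h2 : (s.filter (fun k : Idx a => k.1 = 0)).card ≤ 1 := by
      refine Finset.card_le_one.2 fun x hx y hy => Subtype.ext ?_
      rw [(Finset.mem_filter.1 hx).2, (Finset.mem_filter.1 hy).2]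
    refine (Finset.sum_le_card_nsmul _ _ _ h1).trans ?_
    rw [nsmul_eq_mul]
    exact mul_le_of_le_one_left (by positivity) (by exact_mod_cast h2)
  · have h1 : ∀ k ∈ s.filter (fun k => ¬ k.1 = 0),
        ‖opAFun a p u k‖ ≤ (|1 - p| + |p|) * ‖u (prevIdx k)‖ := by
      intro k hk
      rw [opAFun, if_neg (Finset.mem_filter.1 hk).2, norm_mul, RCLike.norm_ofReal]
      exact mul_le_mul_of_nonneg_right (abs_cf_le a p _) (norm_nonneg _)
    refine (Finset.sum_le_sum h1).trans ?_
    rw [← Finset.mul_sum]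
    refine mul_le_mul_of_nonneg_left ?_ (by positivity)
    have hinj : Set.InjOn (prevIdx (a := a)) (s.filter (fun k : Idx a => ¬ k.1 = 0)) := by
      intro x hx y hy hxy
      have hx' := (Finset.mem_filter.1 hx).2
      have hy' := (Finset.mem_filter.1 hy).2
      have h := congrArg Subtype.val hxy
      simp only [prevIdx] at h
      exact Subtype.ext (by omega)
    rw [← Finset.sum_image (f := fun k => ‖u k‖) hinj, L1.norm_eq]
    exact (L1.summable_norm u).sum_le_tsum _ fun _ _ => norm_nonneg _

/-- The operator `A`, on real (`𝕜 = ℝ`) or complex (`𝕜 = ℂ`) sequences. -/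
def opA (𝕜 : Type) [RCLike 𝕜] (a p : ℝ) : L1 𝕜 a →L[𝕜] L1 𝕜 a :=
  LinearMap.mkContinuous
    { toFun := fun u => ⟨opAFun a p u, memℓp_gen' (C := (|p| + (|1 - p| + |p|)) * ‖u‖)
        (fun s => by simpa using sum_opAFun_le p u s)⟩
      map_add' := fun u w => by
        ext k
        simp only [opAFun, lp.coeFn_add, Pi.add_apply, mul_add]
        rw [(summable_dlt_mul u).tsum_add (summable_dlt_mul w)]
        split_ifs <;> ring
      map_smul' := fun c u => by
        ext k
        simp only [opAFun, lp.coeFn_smul, Pi.smul_apply, smul_eq_mul, RingHom.id_apply,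
          mul_left_comm _ c, tsum_mul_left]
        split_ifs <;> ring } (|p| + (|1 - p| + |p|))
    (fun u => lp.norm_le_of_forall_sum_le (by simp) (by positivity)
      fun s => by simpa using sum_opAFun_le p u s)

/-- The last index `ϰ'_a` (meaningful if `ϰ'_a < ∞`). -/
def lastIdx (a : ℝ) : Idx a := ⟨(kap' a).toNat, ENat.natCast_toNat_le_self _⟩

/-- `k_0`, the smallest integer with `T_a^{k_0}(0) = T_a^{ϰ'_a + 1}(0)` (for `ϰ'_a < ∞`). -/
def k0 (a : ℝ) : ℕ := sInf {k : ℕ | orb a k = orb a ((lastIdx a).1 + 1)}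

/-- The vector with coordinates `1{k = k_0}`. -/
def indK0 (𝕜 : Type) [RCLike 𝕜] (a : ℝ) : L1 𝕜 a :=
  ⟨fun k => if k.1 = k0 a then 1 else 0, memℓp_gen (summable_of_hasFiniteSupport (by
    refine Set.Subsingleton.finite fun x hx y hy => Subtype.ext ?_
    have h : ∀ z : Idx a, z ∈ Function.support (fun k : Idx a =>
        ‖(if k.1 = k0 a then (1 : 𝕜) else 0)‖ ^ (1 : ℝ≥0∞).toReal) → z.1 = k0 a := by
      intro z hz
      by_contra hne
      simp [hne] at hz
    rw [h x hx, h y hy]))⟩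

/-- The operator `Â`: `(Âu)_k = (Au)_k + c_{ϰ'} u_{ϰ'} 1{k = k_0}`. -/
def opAhat (𝕜 : Type) [RCLike 𝕜] (a p : ℝ) : L1 𝕜 a →L[𝕜] L1 𝕜 a :=
  opA 𝕜 a p + (cf a p (lastIdx a) : 𝕜) •
    (lp.evalCLM 𝕜 (fun _ : Idx a => 𝕜) 1 (lastIdx a)).smulRight (indK0 𝕜 a)

/-- The matrix of an operator in the standard basis. -/
def toMat {a : ℝ} (B : L1 ℝ a →L[ℝ] L1 ℝ a) : Matrix (Idx a) (Idx a) ℝ :=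
  Matrix.of fun i j => B (basisVec ℝ j) i

theorem opA_apply {𝕜 : Type} [RCLike 𝕜] (a p : ℝ) (u : L1 𝕜 a) (k : Idx a) :
    opA 𝕜 a p u k = if k.1 = 0 then (p : 𝕜) * ∑' j : Idx a, (dlt a j : 𝕜) * u j
      else (cf a p (k.1 - 1) : 𝕜) * u (prevIdx k) := rfl

theorem opAhat_apply {𝕜 : Type} [RCLike 𝕜] (a p : ℝ) (u : L1 𝕜 a) (k : Idx a) :
    opAhat 𝕜 a p u k = opA 𝕜 a p u k +
      (cf a p (lastIdx a) : 𝕜) * u (lastIdx a) * (if k.1 = k0 a then 1 else 0) := by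
  rw [mul_assoc]; rfl

/-! ### Eigenvectors and the spectral picture -/

/-- `v_k = (p/λ)^k (q/p)^{L_k}`. -/
def vCoord (a p lam : ℝ) (k : ℕ) : ℝ := (p / lam) ^ k * ((1 - p) / p) ^ occ a k

/-- `s = v*_k = ∑_{n=k}^{ϰ_a} δ_n (p/λ)^{n-k+1} (q/p)^{L_n - L_k}` (with a convergent sum). -/
def IsVStarCoord (a p lam : ℝ) (k : ℕ) (s : ℝ) : Prop :=
  HasSum (fun n : {n : ℕ // k ≤ n ∧ (n : ℕ∞) ≤ kap a} =>
    dlt a n * (p / lam) ^ (n.1 - k + 1) * ((1 - p) / p) ^ (occ a n - occ a k)) s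

/-- `V(x) = ∑_{k=0}^{ϰ_a} v_k 1{T_a^k(0) ≤ x}` (with a convergent sum). -/
def IsV (a p lam : ℝ) (V : State a → ℝ) : Prop :=
  ∀ x : State a, HasSum (fun k : {k : ℕ // (k : ℕ∞) ≤ kap a} =>
    vCoord a p lam k * (if orb a k ≤ x.1 then 1 else 0)) (V x)

/-- `λ` is an eigenvalue of `B`, and all other points of the complex spectrum are smaller than
`λ` in modulus. -/
def IsLeadingEigenvalue {a : ℝ} (B : L1 ℂ a →L[ℂ] L1 ℂ a) (lam : ℝ) : Prop :=
  Module.End.HasEigenvalue (B : L1 ℂ a →ₗ[ℂ] L1 ℂ a) (lam : ℂ) ∧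
    ∀ μ ∈ spectrum ℂ B, μ ≠ (lam : ℂ) → ‖μ‖ < lam

/-- `w` is, up to a factor, the only eigenvector of `B` with eigenvalue `λ`. -/
def IsTheEigenvector {E : Type} [NormedAddCommGroup E] [NormedSpace ℝ E] (B : E →L[ℝ] E)
    (lam : ℝ) (w : E) : Prop :=
  w ≠ 0 ∧ Module.End.eigenspace (B : E →ₗ[ℝ] E) lam = Submodule.span ℝ {w}

/-- `λ^{-n} B^n u` converges to `((u, v*)/(v, v*)) v` geometrically fast. -/
def HasSpectralGap {a : ℝ} (B : L1 ℝ a →L[ℝ] L1 ℝ a) (lam : ℝ) (v : L1 ℝ a) (vs : Linf a) : Prop :=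
  ∃ C₁ > (0 : ℝ), ∃ γ ∈ Set.Ioo (0 : ℝ) 1, ∀ (u : L1 ℝ a) (n : ℕ),
    ‖(lam ^ n)⁻¹ • (B ^ n) u - (pair u vs / pair v vs) • v‖ ≤ C₁ * γ ^ n * ‖u‖

end KilledAR

end

open KilledAR

noncomputable section

namespace KilledAR

/-! ### A rank-one perturbation of a power-contracting operator -/

section Gap

variable {E : Type*} [NormedAddCommGroup E] [NormedSpace ℂ E] [CompleteSpace E]

/-! The killed chain is an age-structured population in disguise. For `y = T^j(0)`, applying `P` to
the step `1{x ≥ y}` gives `p δ_j` times the step at `0` plus `c_j` times the step at `T y` (nothing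
if `y` is in the hole); this is `killed_step`. So in the coordinates of the jumps `P` is a Leslie
operator: an individual of age `j` bears `p δ_j` newborns and survives to the next age with weight
`c_j`. `IsRenewalOp` covers `A` and `Â` at once: `fold` identifies times with equal orbit points,
and `cz` stops survival at the hole.

After division by `λ` the operator is `S + φ ⊗ e_0`, with aging `S` and births `φ`, and the
characteristic equation reads `∑ φ(S^n e_0) = 1`. Hence `v = ∑ S^n e_0` and `v*_j = ∑ φ(S^n e_j)`
are the right and left eigenvectors. An eigenvalue `μ` of modulus at least one of the normalized
operator would satisfy `∑ μ^{-n-1} φ(S^n e_0) = 1`; since newborns themselves reproduce (`δ_0 = 1`),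
this forces `μ = 1`. `rankOne_perturbation_gap` turns this into a spectral gap, provided that
`‖S^n‖` decays geometrically.

That decay is the heart of the matter. Both branches of `T` increase and `0` is the least state, so
the itinerary of `0` is lexicographically extremal (`dlt_lex`). Therefore no age has a larger
expected number of discounted births than a newborn (`massFrom_le_one`), and this bounded
reproductive value yields a Lyapunov function for survival (`prodFrom_decay`). The same decay makes
the renewal sum continuous at the candidate root, which gives the existence of `λ`
(`exists_unique_renewal_root`). -/

theorem norm_le_of_mem_spectrum_of_pow_le {S : E →L[ℂ] E} {C γ : ℝ} (hγ : 0 ≤ γ)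
    (hS : ∀ n, ‖S ^ n‖ ≤ C * γ ^ n) {μ : ℂ} (hμ : μ ∈ spectrum ℂ S) : ‖μ‖ ≤ γ := by
  by_contra! hlt
  have hpos : 0 < ‖μ‖ := hγ.trans_lt hlt
  have h1 : ∀ n, ‖μ‖ ^ n ≤ C * γ ^ n * ‖(1 : E →L[ℂ] E)‖ := fun n => by
    have := spectrum.norm_le_norm_mul_of_mem (spectrum.pow_mem_pow S n hμ)
    rw [norm_pow] at this
    exact this.trans (mul_le_mul_of_nonneg_right (hS n) (norm_nonneg _))
  have h2 : ∀ n, (1 : ℝ) ≤ C * ‖(1 : E →L[ℂ] E)‖ * (γ / ‖μ‖) ^ n := fun n => by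
    rw [div_pow, mul_div_assoc', le_div_iff₀ (by positivity)]
    linarith [h1 n]
  have h3 : Tendsto (fun n : ℕ => C * ‖(1 : E →L[ℂ] E)‖ * (γ / ‖μ‖) ^ n) atTop (𝓝 0) := by
    simpa using (tendsto_pow_atTop_nhds_zero_of_lt_one (by positivity)
      ((div_lt_one hpos).2 hlt)).const_mul (C * ‖(1 : E →L[ℂ] E)‖)
  exact absurd (ge_of_tendsto' h3 h2) (by norm_num)

/-- The spectrum is compact, so the pointwise bound puts the spectral radius strictly below one, and
Gelfand's formula bounds the powers. -/
theorem exists_pow_bound_of_spectrum [Nontrivial E] {D : E →L[ℂ] E}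
    (hD : ∀ μ ∈ spectrum ℂ D, ‖μ‖ < 1) :
    ∃ C > (0 : ℝ), ∃ γ ∈ Set.Ioo (0 : ℝ) 1, ∀ n, ‖D ^ n‖ ≤ C * γ ^ n := by
  have h1 : spectralRadius ℂ D < (1 : NNReal) :=
    spectrum.spectralRadius_lt_of_forall_lt D fun z hz => by
      have := hD z hz
      exact_mod_cast this
  obtain ⟨r, hr1, hr2⟩ := ENNReal.lt_iff_exists_nnreal_btwn.1 h1
  have hr : (r : ℝ) < 1 := by exact_mod_cast hr2
  have hr0 : (0 : ℝ) < r := by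
    have : (0 : ℝ≥0∞) < r := bot_le.trans_lt hr1
    exact_mod_cast this
  have h2 := (spectrum.pow_nnnorm_pow_one_div_tendsto_nhds_spectralRadius D).eventually_lt_const hr1
  obtain ⟨N, hN⟩ := eventually_atTop.1 h2
  have h3 : ∀ n ≥ N + 1, ‖D ^ n‖ ≤ (r : ℝ) ^ n := fun n hn => by
    have h := (hN n (by omega)).le
    have hn0 : (n : ℝ) ≠ 0 := by
      have : n ≠ 0 := by omega
      exact_mod_cast this
    have h' := ENNReal.rpow_le_rpow h (Nat.cast_nonneg (α := ℝ) n)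
    rw [← ENNReal.rpow_mul, one_div_mul_cancel hn0, ENNReal.rpow_one, ENNReal.rpow_natCast] at h'
    have h'' : ‖D ^ n‖₊ ≤ r ^ n := by exact_mod_cast h'
    exact_mod_cast h''
  -- The `1` serves the powers from `N + 1` on, the sum serves the finitely many earlier ones.
  refine ⟨1 + ∑ i ∈ Finset.range (N + 1), ‖D ^ i‖ / (r : ℝ) ^ i, by positivity, r, ⟨hr0, hr⟩,
    fun n => ?_⟩
  rcases le_or_gt (N + 1) n with hn | hn
  · refine (h3 n hn).trans (le_mul_of_one_le_left (by positivity) ?_)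
    have : 0 ≤ ∑ i ∈ Finset.range (N + 1), ‖D ^ i‖ / (r : ℝ) ^ i := by positivity
    linarith
  · have h4 : ‖D ^ n‖ / (r : ℝ) ^ n ≤ ∑ i ∈ Finset.range (N + 1), ‖D ^ i‖ / (r : ℝ) ^ i :=
      Finset.single_le_sum (f := fun i => ‖D ^ i‖ / (r : ℝ) ^ i) (fun i _ => by positivity)
        (Finset.mem_range.2 hn)
    rw [← div_le_iff₀ (by positivity)]
    linarith

/-- Subtracting real parts gives `∑ β_n (1 - Re z^{n+1}) = 0` with nonnegative terms. The term `n =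
0` forces `Re z = 1`; positivity of `β 0` plays the role of aperiodicity in the renewal theorem. -/
theorem eq_one_of_hasSum_pow {β : ℕ → ℝ} (hβ0 : ∀ n, 0 ≤ β n) (hβ : HasSum β 1) (hβp : 0 < β 0)
    {z : ℂ} (hz : ‖z‖ ≤ 1) (h : HasSum (fun n => z ^ (n + 1) * (β n : ℂ)) 1) : z = 1 := by
  have h1 : HasSum (fun n => (z ^ (n + 1)).re * β n) 1 := by
    have := Complex.reCLM.hasSum h
    simpa using this
  have h2 : HasSum (fun n => β n * (1 - (z ^ (n + 1)).re)) 0 := by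
    have := hβ.sub h1
    simp only [sub_self] at this
    exact this.congr_fun fun n => by ring
  have hle : ∀ n, (z ^ n).re ≤ 1 := fun n =>
    (Complex.re_le_norm _).trans (by rw [norm_pow]; exact pow_le_one₀ (norm_nonneg _) hz)
  have h3 := (hasSum_zero_iff_of_nonneg (fun n =>
    mul_nonneg (hβ0 n) (sub_nonneg.2 (hle (n + 1))))).1 h2
  have h4 := congrFun h3 0
  simp only [zero_add, pow_one, Pi.zero_apply, mul_eq_zero, hβp.ne', false_or] at h4
  have hre : z.re = 1 := by linarith
  have him : z.im = 0 := by
    have h5 : z.re ^ 2 + z.im ^ 2 ≤ 1 := by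
      have := Complex.sq_norm z
      rw [Complex.normSq_apply] at this
      nlinarith [norm_nonneg z]
    rw [hre] at h5
    nlinarith [sq_nonneg z.im]
  exact Complex.ext (by simpa using hre) (by simpa using him)

/-- If the powers of `S` decay geometrically and `B = S + φ ⊗ e` has the eigenvector `v` and the
left eigenvector `ψ` for the eigenvalue `1`, and `∑ φ (S ^ n e) = 1` is a sum of nonnegative terms
with `φ e > 0`, then `B ^ n` converges geometrically to the projection along `ψ` onto `v`. -/
theorem rankOne_perturbation_gap {S : E →L[ℂ] E} {e v : E} {φ ψ : E →L[ℂ] ℂ} {C γ : ℝ}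
    (hγ0 : 0 ≤ γ) (hγ1 : γ < 1) (hS : ∀ n, ‖S ^ n‖ ≤ C * γ ^ n) (hv : v - S v = e) (hφv : φ v = 1)
    (hψ : ∀ x, ψ x - ψ (S x) = φ x) (hψv : ψ v ≠ 0) {β : ℕ → ℝ} (hβ : ∀ n, φ ((S ^ n) e) = β n)
    (hβ0 : ∀ n, 0 ≤ β n) (hβ1 : HasSum β 1) (hβp : 0 < β 0) {B : E →L[ℂ] E}
    (hB : ∀ x, B x = S x + φ x • e) :
    (∀ μ ∈ spectrum ℂ B, μ ≠ 1 → ‖μ‖ < 1) ∧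
      ∃ C₁ > (0 : ℝ), ∃ γ₁ ∈ Set.Ioo (0 : ℝ) 1, ∀ (x : E) (n : ℕ),
        ‖(B ^ n) x - (ψ x / ψ v) • v‖ ≤ C₁ * γ₁ ^ n * ‖x‖ := by
  have hv0 : v ≠ 0 := by rintro rfl; simp at hψv
  have : Nontrivial E := ⟨v, 0, hv0⟩
  have hunit : ∀ μ : ℂ, 1 ≤ ‖μ‖ → Function.Bijective fun x => μ • x - S x := fun μ hμ => by
    have h1 : IsUnit (algebraMap ℂ (E →L[ℂ] E) μ - S) := by
      by_contra h
      exact absurd (norm_le_of_mem_spectrum_of_pow_le hγ0 hS h) (by linarith)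
    have h2 := ContinuousLinearMap.isUnit_iff_bijective.1 h1
    exact h2
  have hψe : ψ e = 1 := by rw [← hv, map_sub, hψ, hφv]
  have hBv : B v = v := by rw [hB, hφv, one_smul, ← hv]; abel
  have hψB : ∀ x, ψ (B x) = ψ x := fun x => by
    rw [hB, map_add, map_smul, hψe, smul_eq_mul, mul_one, ← hψ]; ring
  -- the resolvent of `S` at `e` takes the value one under `φ` at `μ = 1` only
  have hne : ∀ μ : ℂ, 1 ≤ ‖μ‖ → ∀ y, μ • y - S y = e → φ y = 1 → μ = 1 := by
    intro μ hμ y hy hφy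
    have hμ0 : μ ≠ 0 := by rintro rfl; norm_num at hμ
    -- Iterating `y = μ⁻¹ (e + S y)` gives the Neumann series with remainder. Under `φ` the
    -- remainder tends to zero even on the circle `‖μ‖ = 1`, because `S ^ n` decays.
    have hexp : ∀ n, y = (∑ i ∈ Finset.range n, (μ⁻¹) ^ (i + 1) • (S ^ i) e)
        + (μ⁻¹) ^ n • (S ^ n) y := by
      intro n
      induction n with
      | zero => simp
      | succ n ih =>
        have hy' : y = μ⁻¹ • e + μ⁻¹ • S y := by
          rw [← hy, ← smul_add, sub_add_cancel, smul_smul, inv_mul_cancel₀ hμ0, one_smul]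
        conv_lhs => rw [ih]
        rw [Finset.sum_range_succ, add_assoc]
        congr 1
        conv_lhs => rw [hy']
        rw [map_add, map_smul, map_smul, smul_add, smul_smul, smul_smul, ← pow_succ]
        rfl
    have hsum : Tendsto (fun n => ∑ i ∈ Finset.range n, (μ⁻¹) ^ (i + 1) * (β i : ℂ)) atTop
        (𝓝 1) := by
      have h1 : ∀ n, ∑ i ∈ Finset.range n, (μ⁻¹) ^ (i + 1) * (β i : ℂ)
          = 1 - (μ⁻¹) ^ n * φ ((S ^ n) y) := fun n => by
        have := congrArg φ (hexp n)
        rw [hφy, map_add, map_sum, map_smul] at this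
        simp only [map_smul, hβ, smul_eq_mul] at this
        rw [eq_sub_iff_add_eq, ← this]
      simp only [h1]
      have h2 : Tendsto (fun n => (μ⁻¹) ^ n * φ ((S ^ n) y)) atTop (𝓝 0) := by
        refine squeeze_zero_norm (a := fun n => ‖φ‖ * (C * γ ^ n * ‖y‖)) (fun n => ?_) ?_
        · rw [norm_mul, norm_pow, norm_inv]
          refine (mul_le_of_le_one_left (norm_nonneg _)
            (pow_le_one₀ (by positivity) (inv_le_one_of_one_le₀ hμ))).trans ?_
          refine (φ.le_opNorm _).trans (mul_le_mul_of_nonneg_left ?_ (norm_nonneg _))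
          exact ((S ^ n).le_opNorm _).trans
            (mul_le_mul_of_nonneg_right (hS n) (norm_nonneg _))
        · have := (((tendsto_pow_atTop_nhds_zero_of_lt_one hγ0 hγ1).const_mul C).mul_const
            ‖y‖).const_mul ‖φ‖
          simpa using this
      simpa using h2.const_sub 1
    have hz : ‖μ⁻¹‖ ≤ 1 := by rw [norm_inv]; exact inv_le_one_of_one_le₀ hμ
    have hsm : Summable fun n => (μ⁻¹) ^ (n + 1) * (β n : ℂ) := by
      refine Summable.of_norm_bounded hβ1.summable fun n => ?_
      rw [norm_mul, norm_pow, Complex.norm_real, Real.norm_of_nonneg (hβ0 n)]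
      exact mul_le_of_le_one_left (hβ0 n) (pow_le_one₀ (norm_nonneg _) hz)
    have hs1 : HasSum (fun n => (μ⁻¹) ^ (n + 1) * (β n : ℂ)) 1 := by
      rw [← tendsto_nhds_unique hsm.hasSum.tendsto_sum_nat hsum]; exact hsm.hasSum
    exact inv_eq_one.1 (eq_one_of_hasSum_pow hβ0 hβ1 hβp hz hs1)
  -- injectivity of `μ - B`
  have hinj : ∀ μ : ℂ, 1 ≤ ‖μ‖ → ∀ x, μ • x = B x → ψ x = 0 ∨ μ ≠ 1 → x = 0 := by
    intro μ hμ x hx hor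
    rw [hB] at hx
    by_cases hφ : φ x = 0
    · rw [hφ, zero_smul, add_zero] at hx
      exact (hunit μ hμ).1 (by simp [hx])
    · exfalso
      have hy : μ • ((φ x)⁻¹ • x) - S ((φ x)⁻¹ • x) = e := by
        rw [map_smul, smul_comm, hx, ← smul_sub, add_sub_cancel_left, smul_smul,
          inv_mul_cancel₀ hφ, one_smul]
      have hφy : φ ((φ x)⁻¹ • x) = 1 := by rw [map_smul, smul_eq_mul, inv_mul_cancel₀ hφ]
      have hμ1 := hne μ hμ _ hy hφy
      have hx0 : ψ x = 0 := hor.resolve_right (by simp [hμ1])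
      subst hμ1
      have hyv : (φ x)⁻¹ • x = v := (hunit 1 hμ).1 (by
        change (1 : ℂ) • ((φ x)⁻¹ • x) - S ((φ x)⁻¹ • x) = (1 : ℂ) • v - S v
        rw [hy, one_smul, hv])
      apply hψv
      rw [← hyv, map_smul, hx0, smul_zero]
  -- the spectrum of `B`
  have hsurj : ∀ μ : ℂ, 1 ≤ ‖μ‖ → μ ≠ 1 → ∀ y, ∃ x, μ • x - B x = y := by
    intro μ hμ hμ1 y
    obtain ⟨y0, hy0⟩ := (hunit μ hμ).2 e
    obtain ⟨z, hz⟩ := (hunit μ hμ).2 y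
    simp only at hy0 hz
    -- Sherman–Morrison: the solution `z` for `S` is corrected along the resolvent vector `y0` of
    -- `e`, and the denominator `1 - φ y0` can vanish only at `μ = 1`.
    have h1 : 1 - φ y0 ≠ 0 := fun h => hμ1 (hne μ hμ y0 hy0 (by linear_combination -h))
    refine ⟨z + (φ z / (1 - φ y0)) • y0, ?_⟩
    have h2 : μ • (z + (φ z / (1 - φ y0)) • y0) - B (z + (φ z / (1 - φ y0)) • y0)
        = (μ • z - S z) + (φ z / (1 - φ y0)) • (μ • y0 - S y0)
          - (φ z + (φ z / (1 - φ y0)) * φ y0) • e := by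
      rw [hB, map_add, map_add, map_smul, map_smul, smul_eq_mul]
      module
    rw [h2, hz, hy0]
    have h3 : φ z / (1 - φ y0) = φ z + (φ z / (1 - φ y0)) * φ y0 := by field_simp; ring
    rw [← h3]; abel
  have hspec : ∀ μ ∈ spectrum ℂ B, μ ≠ 1 → ‖μ‖ < 1 := by
    intro μ hμ hμ1
    by_contra! hge
    apply hμ
    refine ContinuousLinearMap.isUnit_iff_bijective.2 ⟨?_, fun y => hsurj μ hge hμ1 y⟩
    refine (injective_iff_map_eq_zero _).2 fun x hx => hinj μ hge x (sub_eq_zero.1 hx) (Or.inr hμ1)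
  refine ⟨hspec, ?_⟩
  -- the operator `D = B - Π`
  let Pi : E →L[ℂ] E := ((ψ v)⁻¹ • ψ).smulRight v
  have hPi : ∀ x, Pi x = (ψ x / ψ v) • v := fun x => by simp [Pi, div_eq_inv_mul]
  have hψPi : ∀ x, ψ (Pi x) = ψ x := fun x => by
    rw [hPi, map_smul, smul_eq_mul, div_mul_cancel₀ _ hψv]
  have hPiv : Pi v = v := by rw [hPi, div_self hψv, one_smul]
  have hPi0 : ∀ x, ψ x = 0 → Pi x = 0 := fun x hx => by rw [hPi, hx, zero_div, zero_smul]
  have hD : ∀ μ ∈ spectrum ℂ (B - Pi), ‖μ‖ < 1 := by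
    intro μ hμ
    by_contra! hge
    have hμ0 : μ ≠ 0 := by rintro rfl; norm_num at hge
    apply hμ
    have hval : ∀ x, (algebraMap ℂ (E →L[ℂ] E) μ - (B - Pi)) x = μ • x - B x + Pi x := fun x => by
      have : (algebraMap ℂ (E →L[ℂ] E) μ - (B - Pi)) x = μ • x - (B x - Pi x) := rfl
      rw [this]; abel
    refine ContinuousLinearMap.isUnit_iff_bijective.2 ⟨?_, fun y => ?_⟩
    · refine (injective_iff_map_eq_zero _).2 fun x hx => ?_
      rw [hval] at hx
      have h1 := congrArg ψ hx
      rw [map_add, map_sub, map_smul, hψB, hψPi, smul_eq_mul, map_zero, sub_add_cancel] at h1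
      have h2 : ψ x = 0 := (mul_eq_zero.1 h1).resolve_left hμ0
      rw [hPi0 x h2, add_zero] at hx
      exact hinj μ hge x (sub_eq_zero.1 hx) (Or.inl h2)
    · -- it suffices to reach the vectors in the kernel of `ψ`
      suffices h : ∀ y, ψ y = 0 → ∃ x, ψ x = 0 ∧ μ • x - B x = y by
        obtain ⟨x, hx0, hx⟩ := h (y - Pi y) (by rw [map_sub, hψPi, sub_self])
        refine ⟨x + μ⁻¹ • Pi y, ?_⟩
        have h3 : Pi (Pi y) = Pi y := by rw [hPi (Pi y), hψPi, ← hPi]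
        have h4 : B (Pi y) = Pi y := by rw [hPi, map_smul, hBv]
        rw [hval, map_add, map_add, map_smul, map_smul, h3, h4, hPi0 x hx0, smul_add, smul_smul,
          mul_inv_cancel₀ hμ0, one_smul]
        calc _ = (μ • x - B x) + Pi y := by abel
          _ = y := by rw [hx]; abel
      intro y hy
      by_cases hμ1 : μ = 1
      · subst hμ1
        -- At `μ = 1` no rank-one correction is needed, since `φ z = ψ y = 0`. Subtracting `Pi z`,
        -- which `B` fixes, moves the solution into the kernel of `ψ`.
        obtain ⟨z, hz⟩ := (hunit 1 hge).2 y
        simp only [one_smul] at hz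
        have hφz : φ z = 0 := by rw [← hψ, ← map_sub, hz, hy]
        refine ⟨z - Pi z, by rw [map_sub, hψPi, sub_self], ?_⟩
        have h4 : B (Pi z) = Pi z := by rw [hPi, map_smul, hBv]
        rw [map_sub, h4, hB, hφz, zero_smul, one_smul, ← hz]
        abel
      · obtain ⟨x, hx⟩ := hsurj μ hge hμ1 y
        refine ⟨x, ?_, hx⟩
        have := congrArg ψ hx
        rw [map_sub, map_smul, hψB, hy, smul_eq_mul, ← sub_one_mul] at this
        exact (mul_eq_zero.1 this).resolve_left (sub_ne_zero.2 hμ1)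
  obtain ⟨C₁, hC₁, γ₁, hγ₁, hpow⟩ := exists_pow_bound_of_spectrum hD
  -- The kernel of `ψ` is invariant under `B` and killed by `Pi`, so there the powers of `B` inherit
  -- the decay of those of `B - Pi`.
  have key : ∀ (x : E), ψ x = 0 → ∀ n : ℕ, ((B - Pi) ^ n) x = (B ^ n) x ∧ ψ ((B ^ n) x) = 0 := by
    intro x hx n
    induction n with
    | zero => exact ⟨rfl, hx⟩
    | succ n ih =>
      have h1 : (B ^ (n + 1)) x = B ((B ^ n) x) := by rw [pow_succ']; rfl
      have h2 : ((B - Pi) ^ (n + 1)) x = B (((B - Pi) ^ n) x) - Pi (((B - Pi) ^ n) x) := by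
        rw [pow_succ']; rfl
      rw [h1, h2, ih.1, hPi0 _ ih.2, sub_zero, hψB]
      exact ⟨rfl, ih.2⟩
  have hBPi : ∀ (x : E) (n : ℕ), (B ^ n) (Pi x) = Pi x := by
    intro x n
    induction n with
    | zero => rfl
    | succ n ih =>
      have h1 : (B ^ (n + 1)) (Pi x) = (B ^ n) (B (Pi x)) := by rw [pow_succ]; rfl
      rw [h1, hPi, map_smul B, hBv, ← hPi, ih]
  refine ⟨C₁ * (‖1 - Pi‖ + 1), by positivity, γ₁, hγ₁, fun x n => ?_⟩
  have h1 : (B ^ n) x - (ψ x / ψ v) • v = ((B - Pi) ^ n) ((1 - Pi) x) := by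
    have h2 : (1 - Pi) x = x - Pi x := rfl
    have h3 : ψ (x - Pi x) = 0 := by rw [map_sub, hψPi, sub_self]
    rw [h2, (key _ h3 n).1, map_sub, hBPi, hPi]
  rw [h1]
  calc _ ≤ ‖(B - Pi) ^ n‖ * (‖1 - Pi‖ * ‖x‖) :=
        ((ContinuousLinearMap.le_opNorm _ _).trans
          (mul_le_mul_of_nonneg_left (ContinuousLinearMap.le_opNorm _ _) (norm_nonneg _)))
    _ ≤ (C₁ * γ₁ ^ n) * ((‖1 - Pi‖ + 1) * ‖x‖) := by
        have := hγ₁.1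
        gcongr
        · exact hpow n
        · linarith
    _ = _ := by ring

end Gap

/-! ### Renewal equations -/

/-- A renewal equation whose terms decay geometrically wherever its sum is at most one has exactly
one solution. -/
theorem exists_unique_renewal_root {b : ℕ → ℝ} (hb0 : ∀ n, 0 ≤ b n) (hb1 : ∀ n, b n ≤ 1)
    (hb : 0 < b 0) (hk : ∃ k, k ≠ 0 ∧ 0 < b k)
    (hdecay : ∀ l, b 0 < l → (∀ N, ∑ n ∈ Finset.range N, b n / l ^ (n + 1) ≤ 1) →
      ∃ C : ℝ, ∃ γ ∈ Set.Ioo (0 : ℝ) 1, ∀ n, b n / l ^ (n + 1) ≤ C * γ ^ n) :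
    ∃ l, b 0 < l ∧ HasSum (fun n => b n / l ^ (n + 1)) 1 ∧
      ∀ m, 0 < m → HasSum (fun n => b n / m ^ (n + 1)) 1 → m = l := by
  -- The root is the infimum of this set. It is stated through partial sums because convergence near
  -- the root is not known in advance.
  let s : Set ℝ := {l | 0 < l ∧ ∀ N, ∑ n ∈ Finset.range N, b n / l ^ (n + 1) ≤ 1}
  have h2 : (2 : ℝ) ∈ s := by
    refine ⟨two_pos, fun N => ?_⟩
    have h : ∀ N, ∑ n ∈ Finset.range N, b n / (2 : ℝ) ^ (n + 1) ≤ 1 - 1 / 2 ^ N := by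
      intro N
      induction N with
      | zero => simp
      | succ N ih =>
        rw [Finset.sum_range_succ]
        have h1 : b N / (2 : ℝ) ^ (N + 1) ≤ 1 / 2 ^ (N + 1) := by gcongr; exact hb1 N
        have h3 : (1 : ℝ) / 2 ^ N = 1 / 2 ^ (N + 1) + 1 / 2 ^ (N + 1) := by
          rw [pow_succ]; field_simp; norm_num
        linarith
    exact (h N).trans (by linarith [show (0 : ℝ) ≤ 1 / 2 ^ N by positivity])
  have hlb : ∀ l ∈ s, b 0 ≤ l := fun l hl => by
    have := hl.2 1
    rw [Finset.sum_range_one, zero_add, pow_one] at this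
    rwa [div_le_one hl.1] at this
  have hbdd : BddBelow s := ⟨b 0, hlb⟩
  set l := sInf s with hl
  have hbl : b 0 ≤ l := le_csInf ⟨2, h2⟩ hlb
  have hl0 : 0 < l := hb.trans_le hbl
  have hup : ∀ m, l < m → m ∈ s := by
    intro m hm
    obtain ⟨t, ht, htm⟩ := exists_lt_of_csInf_lt ⟨2, h2⟩ hm
    refine ⟨hl0.trans hm, fun N => (Finset.sum_le_sum fun n _ => ?_).trans (ht.2 N)⟩
    exact div_le_div_of_nonneg_left (hb0 n) (pow_pos ht.1 _) (pow_le_pow_left₀ ht.1.le htm.le _)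
  have hls : l ∈ s := by
    refine ⟨hl0, fun N => ?_⟩
    have hc : ContinuousAt (fun m : ℝ => ∑ n ∈ Finset.range N, b n / m ^ (n + 1)) l := by
      refine tendsto_finsetSum _ fun n _ => ?_
      exact ContinuousAt.div continuousAt_const (continuousAt_id.pow _) (pow_pos hl0 _).ne'
    refine le_of_tendsto (hc.tendsto.mono_left (nhdsWithin_le_nhds (s := Set.Ioi l))) ?_
    filter_upwards [self_mem_nhdsWithin] with m hm using (hup m hm).2 N
  -- The second positive coefficient makes the inequality strict, as `hdecay` requires.
  have hbl' : b 0 < l := by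
    obtain ⟨k, hk0, hk⟩ := hk
    have h1 := hls.2 (k + 1)
    have h3 : b 0 / l ^ (0 + 1) + b k / l ^ (k + 1)
        ≤ ∑ n ∈ Finset.range (k + 1), b n / l ^ (n + 1) := by
      rw [← Finset.sum_pair (f := fun n => b n / l ^ (n + 1)) hk0.symm]
      refine Finset.sum_le_sum_of_subset_of_nonneg ?_ fun n _ _ =>
        div_nonneg (hb0 n) (pow_pos hl0 _).le
      intro i hi
      simp only [Finset.mem_insert, Finset.mem_singleton] at hi
      rw [Finset.mem_range]; omega
    have h4 : 0 < b k / l ^ (k + 1) := div_pos hk (pow_pos hl0 _)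
    have h5 : b 0 / l ^ (0 + 1) < 1 := by linarith
    rwa [zero_add, pow_one, div_lt_one hl0] at h5
  have hterm0 : ∀ n, 0 ≤ b n / l ^ (n + 1) := fun n => div_nonneg (hb0 n) (pow_pos hl0 _).le
  have hsm : Summable fun n => b n / l ^ (n + 1) := summable_of_sum_range_le hterm0 hls.2
  have hle : ∑' n, b n / l ^ (n + 1) ≤ 1 := hsm.tsum_le_of_sum_range_le hls.2
  have heq : ∑' n, b n / l ^ (n + 1) = 1 := by
    -- If the sum at `l` were below one, geometric decay would make it continuous from the left, so
    -- some `t * l` with `t < 1` would still belong to `s`.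
    refine hle.antisymm (not_lt.1 fun hlt => ?_)
    obtain ⟨C, γ, ⟨hγ0, hγ1⟩, hC⟩ := hdecay l hbl' hls.2
    -- Keeping `t` above `t0 > γ` gives one geometric majorant, of ratio `γ / t0`, for all `t` in
    -- `(t0, 1)`.
    obtain ⟨t0, hγt, ht01⟩ := exists_between hγ1
    have ht00 : 0 < t0 := hγ0.trans hγt
    have hgeo : Summable fun n => C / t0 * (γ / t0) ^ n :=
      (summable_geometric_of_lt_one (by positivity) ((div_lt_one ht00).2 hγt)).mul_left _
    have hbound : ∀ t ∈ Set.Ioo t0 1, ∀ n, b n / (t * l) ^ (n + 1) ≤ C / t0 * (γ / t0) ^ n := by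
      intro t ht n
      have ht0' : 0 < t := ht00.trans ht.1
      rw [mul_pow, mul_comm, ← div_div]
      calc b n / l ^ (n + 1) / t ^ (n + 1) ≤ C * γ ^ n / t0 ^ (n + 1) := by
            gcongr
            · exact (hterm0 n).trans (hC n)
            · exact hC n
            · exact ht.1.le
        _ = _ := by rw [div_pow, pow_succ]; field_simp
    have hlim : Tendsto (fun t : ℝ => ∑' n, b n / (t * l) ^ (n + 1)) (𝓝[<] 1)
        (𝓝 (∑' n, b n / l ^ (n + 1))) := by
      refine tendsto_tsum_of_dominated_convergence
        (bound := fun n => C / t0 * (γ / t0) ^ n) ?_ (fun n => ?_) ?_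
      · exact hgeo
      · have hc : ContinuousAt (fun t : ℝ => b n / (t * l) ^ (n + 1)) 1 := by
          refine ContinuousAt.div continuousAt_const (by fun_prop) ?_
          rw [one_mul]; exact (pow_pos hl0 _).ne'
        have := hc.tendsto
        simp only [one_mul] at this
        exact this.mono_left nhdsWithin_le_nhds
      · filter_upwards [Ioo_mem_nhdsLT ht01] with t ht n
        have ht0' : 0 < t := ht00.trans ht.1
        rw [Real.norm_of_nonneg (div_nonneg (hb0 n) (by positivity))]
        exact hbound t ht n
    have hev := (hlim.eventually_lt_const hlt).and (Ioo_mem_nhdsLT ht01)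
    obtain ⟨t, htlt, ht⟩ := hev.exists
    have ht0' : 0 < t := ht00.trans ht.1
    have hsm' : Summable fun n => b n / (t * l) ^ (n + 1) :=
      Summable.of_nonneg_of_le (fun n => div_nonneg (hb0 n) (by positivity)) (hbound t ht) hgeo
    have hmem : t * l ∈ s := ⟨by positivity, fun N =>
      (hsm'.sum_le_tsum _ fun n _ => div_nonneg (hb0 n) (by positivity)).trans htlt.le⟩
    have := csInf_le hbdd hmem
    nlinarith [ht.2]
  have hsum : HasSum (fun n => b n / l ^ (n + 1)) 1 := heq ▸ hsm.hasSum
  have hanti : ∀ m m', 0 < m → m < m' → HasSum (fun n => b n / m ^ (n + 1)) 1 →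
      HasSum (fun n => b n / m' ^ (n + 1)) 1 → False := by
    intro m m' hm hmm h h'
    refine lt_irrefl (1 : ℝ) (hasSum_lt (fun n => ?_) (i := 0) ?_ h' h)
    · exact div_le_div_of_nonneg_left (hb0 n) (pow_pos hm _) (pow_le_pow_left₀ hm.le hmm.le _)
    · simp only [zero_add, pow_one]
      exact div_lt_div_of_pos_left hb hm hmm
  refine ⟨l, hbl', hsum, fun m hm hms => ?_⟩
  rcases lt_trichotomy m l with h | h | h
  · exact (hanti m l hm h hms hsum).elim
  · exact h
  · exact (hanti l m hl0 h hsum hms).elim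

/-- The product `r_j ⋯ r_{j+n-1}`. -/
def prodFrom (r : ℕ → ℝ) (j n : ℕ) : ℝ := ∏ i ∈ Finset.range n, r (j + i)

theorem prodFrom_zero (r : ℕ → ℝ) (j : ℕ) : prodFrom r j 0 = 1 := by simp [prodFrom]

theorem prodFrom_succ (r : ℕ → ℝ) (j n : ℕ) :
    prodFrom r j (n + 1) = prodFrom r j n * r (j + n) := Finset.prod_range_succ _ _

theorem prodFrom_add (r : ℕ → ℝ) (j m n : ℕ) :
    prodFrom r j (m + n) = prodFrom r j m * prodFrom r (j + m) n := by
  simp only [prodFrom, Finset.prod_range_add, add_assoc]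

theorem prodFrom_succ' (r : ℕ → ℝ) (j n : ℕ) :
    prodFrom r j (n + 1) = r j * prodFrom r (j + 1) n := by
  rw [add_comm n 1, prodFrom_add, prodFrom_succ, prodFrom_zero, one_mul, add_zero]

theorem prodFrom_nonneg {r : ℕ → ℝ} (hr : ∀ i, 0 ≤ r i) (j n : ℕ) : 0 ≤ prodFrom r j n :=
  Finset.prod_nonneg fun _ _ => hr _

theorem prodFrom_congr {r r' : ℕ → ℝ} {j j' n : ℕ} (h : ∀ i < n, r (j + i) = r' (j' + i)) :
    prodFrom r j n = prodFrom r' j' n :=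
  Finset.prod_congr rfl fun i hi => h i (Finset.mem_range.1 hi)

theorem prodFrom_div (c : ℕ → ℝ) (l : ℝ) (j n : ℕ) :
    prodFrom (fun i => c i / l) j n = prodFrom c j n / l ^ n := by
  simp [prodFrom, Finset.prod_div_distrib]

/-- The partial sums of the renewal mass `∑_n d_{j+n} x r_j ⋯ r_{j+n-1}` seen from the age `j`. -/
def massFrom (x : ℝ) (d r : ℕ → ℝ) (j N : ℕ) : ℝ :=
  ∑ n ∈ Finset.range N, x * d (j + n) * prodFrom r j n

theorem massFrom_add (x : ℝ) (d r : ℕ → ℝ) (j m n : ℕ) :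
    massFrom x d r j (m + n) = massFrom x d r j m + prodFrom r j m * massFrom x d r (j + m) n := by
  simp only [massFrom, Finset.sum_range_add, Finset.mul_sum, prodFrom_add, add_assoc]
  congr 1
  exact Finset.sum_congr rfl fun i _ => by ring

theorem massFrom_one (x : ℝ) (d r : ℕ → ℝ) (j : ℕ) : massFrom x d r j 1 = x * d j := by
  simp [massFrom, prodFrom_zero]

/-! ### Geometric decay of survival products. -/

section Decay

variable {x Q : ℝ} {d r : ℕ → ℝ}

/-- If the itinerary of every age is at least the one of zero in the lexicographic order, the
renewal mass of every age is at most one as soon as the one of zero is. -/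
theorem massFrom_le_one (hx : 0 < x) (hQ : 0 < Q)
    (hdr : ∀ i, (d i = 1 ∧ r i = Q) ∨ (d i = 0 ∧ r i = x))
    (hlex : ∀ j n, (∀ i < n, d (j + i) = d i) → d (j + n) ≤ d n)
    (h0 : ∀ N, massFrom x d r 0 N ≤ 1) (N j : ℕ) : massFrom x d r j N ≤ 1 := by
  have hr : ∀ i j, d i = d j → r i = r j := fun i j h => by
    rcases hdr i with ⟨h1, h2⟩ | ⟨h1, h2⟩ <;> rcases hdr j with ⟨h3, h4⟩ | ⟨h3, h4⟩
    · rw [h2, h4]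
    · rw [h1, h3] at h; norm_num at h
    · rw [h1, h3] at h; norm_num at h
    · rw [h2, h4]
  have hr0 : ∀ i, 0 ≤ r i := fun i => by
    rcases hdr i with ⟨_, h⟩ | ⟨_, h⟩ <;> rw [h] <;> positivity
  have hagree : ∀ j n, (∀ i < n, d (j + i) = d i) →
      massFrom x d r j n = massFrom x d r 0 n ∧ prodFrom r j n = prodFrom r 0 n := by
    intro j n h
    have hp : ∀ m ≤ n, prodFrom r j m = prodFrom r 0 m := fun m hm =>
      prodFrom_congr fun i hi => hr _ _ (by rw [h i (by omega), zero_add])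
    refine ⟨Finset.sum_congr rfl fun i hi => ?_, hp n le_rfl⟩
    have hi' := Finset.mem_range.1 hi
    rw [h i hi', zero_add, hp i hi'.le]
  induction N using Nat.strong_induction_on generalizing j with
  | _ N ih =>
    by_cases h : ∀ i < N, d (j + i) = d i
    · rw [(hagree j N h).1]; exact h0 N
    · push Not at h
      classical
      obtain ⟨n, hn, hmin⟩ : ∃ n, (n < N ∧ d (j + n) ≠ d n) ∧ ∀ i < n, d (j + i) = d i :=
        ⟨Nat.find h, Nat.find_spec h, fun i hi => by
          by_contra hne
          exact Nat.find_min h hi ⟨hi.trans (Nat.find_spec h).1, hne⟩⟩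
      have hle := hlex j n hmin
      have hd : d (j + n) = 0 ∧ r (j + n) = x ∧ d n = 1 := by
        rcases hdr (j + n) with ⟨h1, h2⟩ | ⟨h1, h2⟩ <;> rcases hdr n with ⟨h3, h4⟩ | ⟨h3, h4⟩
        · exact absurd (h1.trans h3.symm) hn.2
        · rw [h1, h3] at hle; norm_num at hle
        · exact ⟨h1, h2, h3⟩
        · exact absurd (h1.trans h3.symm) hn.2
      -- At the first disagreement age `j + n` bears nothing and survives with factor `x`, while age
      -- `n` bears `x`. By induction the future of `j + n + 1` is worth at most one, hence at most
      -- `x` after discounting, so it does not exceed the birth credited to age `n`.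
      obtain ⟨N', rfl⟩ : ∃ N', N = n + (1 + N') := ⟨N - n - 1, by omega⟩
      have hI := ih N' (by omega) (j + n + 1)
      rw [massFrom_add, massFrom_add, massFrom_one, hd.1, (hagree j n hmin).1,
        (hagree j n hmin).2, prodFrom_succ, prodFrom_zero, add_zero, hd.2.1]
      have hF := h0 (n + 1)
      rw [massFrom_add, massFrom_one, zero_add, hd.2.2] at hF
      have hP := prodFrom_nonneg hr0 0 n
      have : prodFrom r 0 n * (x * massFrom x d r (j + n + 1) N') ≤ prodFrom r 0 n * (x * 1) := by
        gcongr
      linarith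

/-- If the renewal mass is at most one for all ages, the survival probabilities decay
geometrically, uniformly in the age. -/
theorem prodFrom_decay (hx : 0 < x) (hx1 : x < 1) (hQ : 0 < Q)
    (hdr : ∀ i, (d i = 1 ∧ r i = Q) ∨ (d i = 0 ∧ r i = x))
    (hmass : ∀ N j, massFrom x d r j N ≤ 1) :
    ∃ C : ℝ, ∃ γ ∈ Set.Ioo (0 : ℝ) 1, ∀ j n, prodFrom r j n ≤ C * γ ^ n := by
  have hr0 : ∀ i, 0 ≤ r i := fun i => by
    rcases hdr i with ⟨_, h⟩ | ⟨_, h⟩ <;> rw [h] <;> positivity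
  have hd0 : ∀ i, 0 ≤ d i := fun i => by rcases hdr i with ⟨h, _⟩ | ⟨h, _⟩ <;> rw [h]; norm_num
  have hterm : ∀ j n, 0 ≤ x * d (j + n) * prodFrom r j n := fun j n =>
    mul_nonneg (mul_nonneg hx.le (hd0 _)) (prodFrom_nonneg hr0 _ _)
  have hsm : ∀ j, Summable fun n => x * d (j + n) * prodFrom r j n := fun j =>
    summable_of_sum_range_le (hterm j) fun N => hmass N j
  let w : ℕ → ℝ := fun j => ∑' n, x * d (j + n) * prodFrom r j n
  have hw0 : ∀ j, 0 ≤ w j := fun j => tsum_nonneg (hterm j)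
  have hw1 : ∀ j, w j ≤ 1 := fun j => (hsm j).tsum_le_of_sum_range_le fun N => hmass N j
  have hw : ∀ j, w j = x * d j + r j * w (j + 1) := fun j => by
    change ∑' n, _ = _
    rw [(hsm j).tsum_eq_zero_add]
    simp only [add_zero, prodFrom_zero, mul_one]
    congr 1
    rw [← tsum_mul_left]
    refine tsum_congr fun n => ?_
    rw [prodFrom_succ', add_assoc j 1 n, add_comm 1 n]; ring
  -- `w + ε` is the Lyapunov function; the shift keeps it positive where `w` vanishes. With a birth,
  -- `Q w_{j+1} = w_j - x` and `Q ε = x / 2`, so the loss is `x / 2` and `w ≤ 1` makes it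
  -- proportional. Without a birth, only `ε` shrinks, by the factor `x < 1`, and `w ≤ 1` again gives
  -- a uniform ratio. The two terms of `γ` are these two cases.
  set ε := x / (2 * Q) with hε
  have hε0 : 0 < ε := by positivity
  have hQε : Q * ε = x / 2 := by rw [hε]; field_simp
  set γ := max (1 - x / 2) ((1 + x * ε) / (1 + ε)) with hγ
  have hγ0 : 0 < γ := lt_max_of_lt_left (by linarith)
  have hγ1 : γ < 1 := max_lt (by linarith) ((div_lt_one (by positivity)).2 (by nlinarith))
  have hγa : 1 - x / 2 ≤ γ := le_max_left _ _
  have hγb : 1 + x * ε ≤ γ * (1 + ε) := by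
    rw [← div_le_iff₀ (by positivity)]; exact le_max_right _ _
  have hstep : ∀ j, r j * (w (j + 1) + ε) ≤ γ * (w j + ε) := by
    intro j
    have h1 := hw j
    have h2 := hw1 j
    have h3 := hw0 j
    rcases hdr j with ⟨hd, hr⟩ | ⟨hd, hr⟩
    · rw [hd, hr] at h1
      rw [hr, mul_add, hQε]
      have h4 : w j - x / 2 ≤ (1 - x / 2) * w j := by nlinarith
      have h5 : (1 - x / 2) * w j ≤ γ * w j := mul_le_mul_of_nonneg_right hγa h3
      have h6 : 0 < γ * ε := by positivity
      nlinarith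
    · rw [hd, hr] at h1
      rw [hr]
      nlinarith
  have hiter : ∀ n j, prodFrom r j n * (w (j + n) + ε) ≤ γ ^ n * (w j + ε) := by
    intro n
    induction n with
    | zero => intro j; simp [prodFrom_zero]
    | succ n ih =>
      intro j
      calc prodFrom r j (n + 1) * (w (j + (n + 1)) + ε)
          = prodFrom r j n * (r (j + n) * (w (j + n + 1) + ε)) := by
            rw [prodFrom_succ, mul_assoc, add_assoc]
        _ ≤ prodFrom r j n * (γ * (w (j + n) + ε)) :=
            mul_le_mul_of_nonneg_left (hstep _) (prodFrom_nonneg hr0 _ _)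
        _ = γ * (prodFrom r j n * (w (j + n) + ε)) := by ring
        _ ≤ γ * (γ ^ n * (w j + ε)) := mul_le_mul_of_nonneg_left (ih j) hγ0.le
        _ = _ := by ring
  refine ⟨(1 + ε) / ε, γ, ⟨hγ0, hγ1⟩, fun j n => ?_⟩
  rw [div_mul_eq_mul_div, le_div_iff₀ hε0]
  calc prodFrom r j n * ε ≤ prodFrom r j n * (w (j + n) + ε) :=
        mul_le_mul_of_nonneg_left (by linarith [hw0 (j + n)]) (prodFrom_nonneg hr0 _ _)
    _ ≤ γ ^ n * (w j + ε) := hiter n j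
    _ ≤ γ ^ n * (1 + ε) := by gcongr; exact hw1 j
    _ = _ := by ring

end Decay

/-- Products of boundedly many factors decay geometrically. -/
theorem prodFrom_decay_of_eq_zero {r : ℕ → ℝ} {R : ℝ} (hr0 : ∀ i, 0 ≤ r i) (hR : ∀ i, r i ≤ R)
    {K : ℕ} (hK : ∀ i, K ≤ i → r i = 0) :
    ∃ C : ℝ, ∃ γ ∈ Set.Ioo (0 : ℝ) 1, ∀ j n, prodFrom r j n ≤ C * γ ^ n := by
  have hR' : ∀ i, r i ≤ max R 1 := fun i => (hR i).trans (le_max_left _ _)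
  have h1 : ∀ j n, prodFrom r j n ≤ (max R 1) ^ n := fun j n => by
    refine (Finset.prod_le_prod (fun i _ => hr0 _) fun i _ => hR' (j + i)).trans ?_
    simp
  have hM1 : 1 ≤ max R 1 := le_max_right _ _
  refine ⟨(max R 1) ^ K * 2 ^ K, 1 / 2, by norm_num, fun j n => ?_⟩
  rcases le_or_gt n K with hn | hn
  · refine (h1 j n).trans ((pow_le_pow_right₀ hM1 hn).trans ?_)
    rw [mul_assoc]
    refine le_mul_of_one_le_right (by positivity) ?_
    rw [one_div, inv_pow, ← div_eq_mul_inv, one_le_div (by positivity)]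
    exact pow_le_pow_right₀ (by norm_num) hn
  · have : prodFrom r j n = 0 :=
      Finset.prod_eq_zero (Finset.mem_range.2 hn) (hK _ (by omega))
    rw [this]; positivity

/-! ### The orbit of zero -/

theorem orb_zero (a : ℝ) : orb a 0 = 0 := rfl

theorem orb_succ (a : ℝ) (k : ℕ) : orb a (k + 1) = T a (orb a k) :=
  Function.iterate_succ_apply' _ _ _

theorem orb_add_eq {a : ℝ} {i j : ℕ} (h : orb a i = orb a j) (m : ℕ) :
    orb a (i + m) = orb a (j + m) := by
  induction m with
  | zero => exact h
  | succ m ih => rw [← add_assoc, ← add_assoc, orb_succ, orb_succ, ih]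

theorem kap_cases (a : ℝ) : (kap a = ⊤ ∧ ∀ k, orb a k ∉ hole a) ∨
    ∃ K : ℕ, kap a = K ∧ orb a K ∈ hole a ∧ ∀ k < K, orb a k ∉ hole a := by
  classical
  by_cases h : ∃ k, orb a k ∈ hole a
  · refine Or.inr ⟨Nat.find h, le_antisymm
      (iInf₂_le (f := fun (k : ℕ) (_ : orb a k ∈ hole a) => (k : ℕ∞)) _ (Nat.find_spec h)) ?_,
      Nat.find_spec h, fun k hk => Nat.find_min h hk⟩
    exact le_iInf₂ fun k hk => by exact_mod_cast Nat.find_min' h hk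
  · push Not at h
    exact Or.inl ⟨by simp [kap, h], h⟩

theorem orb_notMem_hole {a : ℝ} {k : ℕ} (hk : (k : ℕ∞) < kap a) : orb a k ∉ hole a :=
  fun h => absurd (iInf₂_le (f := fun (k : ℕ) (_ : orb a k ∈ hole a) => (k : ℕ∞)) k h)
    (not_le.2 hk)

theorem encard_Iio_succ_sub_one (m : ℕ) : (Set.Iio (m + 1)).encard - 1 = (m : ℕ∞) := by
  have h : Set.Iio (m + 1) = (Finset.range (m + 1) : Set ℕ) := by ext; simp
  rw [h, Set.encard_coe_eq_coe_finsetCard, Finset.card_range]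
  exact_mod_cast rfl

/-- Three kinds of orbit: one that ends in the hole, an infinite injective one, and an infinite one
with a repetition. In each kind the indices up to `kap'` label the distinct points exactly once,
which makes `Idx` the right index set. -/
theorem kap'_structure (a : ℝ) : (kap a = kap' a ∨ kap a = ⊤) ∧
    (∀ i j : ℕ, (i : ℕ∞) ≤ kap' a → (j : ℕ∞) ≤ kap' a → orb a i = orb a j → i = j) ∧
    ∀ k : ℕ, (k : ℕ∞) ≤ kap a → ∃ j : ℕ, (j : ℕ∞) ≤ kap' a ∧ orb a j = orb a k := by
  classical
  rcases kap_cases a with ⟨hk, -⟩ | ⟨K, hK, hmem, hmin⟩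
  · have hset : {y : ℝ | ∃ k : ℕ, (k : ℕ∞) ≤ kap a ∧ y = orb a k} = Set.range (orb a) := by
      ext y; simp [hk, eq_comm]
    by_cases hinj : Function.Injective (orb a)
    · have hk' : kap' a = ⊤ := by
        rw [kap', hset, (Set.infinite_range_of_injective hinj).encard_eq]; rfl
      exact ⟨Or.inr hk, fun i j _ _ h => hinj h, fun k _ => ⟨k, by simp [hk'], rfl⟩⟩
    · have hex : ∃ n, ∃ i < n, orb a i = orb a n := by
        simp only [Function.Injective, not_forall] at hinj
        obtain ⟨i, j, h, hne⟩ := hinj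
        rcases lt_or_gt_of_ne hne with hij | hij
        · exact ⟨j, i, hij, h⟩
        · exact ⟨i, j, hij, h.symm⟩
      -- With `n` the first time of a repetition, the first `n` points are distinct and exhaust the
      -- orbit, so `kap' = n - 1`.
      obtain ⟨n, ⟨i, hin, hi⟩, hn⟩ : ∃ n, (∃ i < n, orb a i = orb a n) ∧
          ∀ m < n, ∀ i < m, orb a i ≠ orb a m :=
        ⟨Nat.find hex, Nat.find_spec hex, fun m hm i him h => Nat.find_min hex hm ⟨i, him, h⟩⟩
      have hinjOn : Set.InjOn (orb a) (Set.Iio n) := by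
        intro k hk l hl h
        by_contra hne
        rcases lt_or_gt_of_ne hne with h1 | h1
        · exact hn l hl k h1 h
        · exact hn k hk l h1 h.symm
      have hall : ∀ k, ∃ j < n, orb a j = orb a k := by
        intro k
        induction k using Nat.strong_induction_on with
        | _ k ih =>
          by_cases hkn : k < n
          · exact ⟨k, hkn, rfl⟩
          · obtain ⟨m, rfl⟩ := Nat.exists_eq_add_of_le (not_lt.1 hkn)
            obtain ⟨j, hj, hj'⟩ := ih (i + m) (by omega)
            exact ⟨j, hj, hj'.trans (orb_add_eq hi m)⟩
      have hrange : Set.range (orb a) = orb a '' Set.Iio n := by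
        ext y
        simp only [Set.mem_range, Set.mem_image, Set.mem_Iio]
        constructor
        · rintro ⟨k, rfl⟩; exact hall k
        · rintro ⟨k, -, rfl⟩; exact ⟨k, rfl⟩
      obtain ⟨m, rfl⟩ : ∃ m, n = m + 1 := ⟨n - 1, by omega⟩
      have hk' : kap' a = m := by
        rw [kap', hset, hrange, hinjOn.encard_image, encard_Iio_succ_sub_one]
      refine ⟨Or.inr hk, fun k l hk hl h => hinjOn ?_ ?_ h, fun k _ => ?_⟩
      · rw [hk', Nat.cast_le] at hk; exact Nat.lt_succ_of_le hk
      · rw [hk', Nat.cast_le] at hl; exact Nat.lt_succ_of_le hl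
      · obtain ⟨j, hj, hj'⟩ := hall k
        exact ⟨j, by rw [hk', Nat.cast_le]; omega, hj'⟩
  -- A repetition before the hole, shifted forward by `K - j`, would put the orbit in the hole
  -- before time `K`.
  · have hlt : ∀ i j, i < j → j ≤ K → orb a i ≠ orb a j := by
      intro i j hij hjK h
      have := orb_add_eq h (K - j)
      rw [Nat.add_sub_cancel' hjK] at this
      exact hmin (i + (K - j)) (by omega) (this ▸ hmem)
    have hinjOn : Set.InjOn (orb a) (Set.Iio (K + 1)) := by
      intro k hk l hl h
      by_contra hne
      simp only [Set.mem_Iio] at hk hl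
      rcases lt_or_gt_of_ne hne with h1 | h1
      · exact hlt k l h1 (by omega) h
      · exact hlt l k h1 (by omega) h.symm
    have hset : {y : ℝ | ∃ k : ℕ, (k : ℕ∞) ≤ kap a ∧ y = orb a k} = orb a '' Set.Iio (K + 1) := by
      ext y
      simp only [hK, Nat.cast_le, Set.mem_ofPred_eq, Set.mem_image, Set.mem_Iio, Nat.lt_succ_iff]
      simp only [eq_comm]
    have hk' : kap' a = K := by
      rw [kap', hset, hinjOn.encard_image, encard_Iio_succ_sub_one]
    refine ⟨Or.inl (hK.trans hk'.symm), fun k l hk hl h => hinjOn ?_ ?_ h, fun k h => ⟨k, ?_, rfl⟩⟩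
    · rw [hk', Nat.cast_le] at hk; exact Nat.lt_succ_of_le hk
    · rw [hk', Nat.cast_le] at hl; exact Nat.lt_succ_of_le hl
    · rwa [hk', ← hK]

theorem kap'_le_kap (a : ℝ) : kap' a ≤ kap a := by
  rcases (kap'_structure a).1 with h | h
  · exact h.ge
  · rw [h]; exact le_top

theorem Idx.le_kap {a : ℝ} (k : Idx a) : (k.1 : ℕ∞) ≤ kap a := k.2.trans (kap'_le_kap a)

theorem orb_injective {a : ℝ} : Function.Injective fun k : Idx a => orb a k := fun i j h =>
  Subtype.ext ((kap'_structure a).2.1 i j i.2 j.2 h)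

theorem exists_idx_orb_eq {a : ℝ} {k : ℕ} (hk : (k : ℕ∞) ≤ kap a) :
    ∃ j : Idx a, orb a j = orb a k := by
  obtain ⟨j, hj, h⟩ := (kap'_structure a).2.2 k hk
  exact ⟨⟨j, hj⟩, h⟩

open Classical in
/-- The index of the point `T_a^k(0)` in the list of the distinct points of the orbit of zero. -/
def fold (a : ℝ) (k : ℕ) : Idx a :=
  if hk : (k : ℕ∞) ≤ kap a then (exists_idx_orb_eq hk).choose else lastIdx a

theorem orb_fold {a : ℝ} {k : ℕ} (hk : (k : ℕ∞) ≤ kap a) : orb a (fold a k) = orb a k := by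
  rw [fold, dif_pos hk]; exact (exists_idx_orb_eq hk).choose_spec

theorem fold_eq_of_orb_eq {a : ℝ} {k : ℕ} (hk : (k : ℕ∞) ≤ kap a) {j : Idx a}
    (h : orb a j = orb a k) : fold a k = j :=
  orb_injective ((orb_fold hk).trans h.symm)

theorem fold_coe {a : ℝ} (j : Idx a) : fold a j = j := fold_eq_of_orb_eq j.le_kap rfl

theorem fold_of_kap_le {a : ℝ} {k : ℕ} (hk : kap a ≤ k) : fold a k = lastIdx a := by
  rcases hk.lt_or_eq with h | h
  · rw [fold, dif_neg (not_le.2 h)]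
  · have h1 : kap a = kap' a := (kap'_structure a).1.resolve_right (by rw [h]; simp)
    have h2 : (lastIdx a).1 = k := by simp [lastIdx, ← h1, h]
    rw [← h2, fold_coe]

theorem kap_le_of_le {a : ℝ} {k l : ℕ} (hk : kap a ≤ k) (hkl : k ≤ l) : kap a ≤ l :=
  hk.trans (by exact_mod_cast hkl)

theorem lastIdx_val {a : ℝ} (h : kap a < ⊤) : ((lastIdx a).1 : ℕ∞) = kap a := by
  have h1 : kap a = kap' a := (kap'_structure a).1.resolve_right h.ne
  have h2 : kap' a ≠ ⊤ := h1 ▸ h.ne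
  rw [h1]; simp [lastIdx, ENat.natCast_toNat h2]

/-- Folding commutes with the passage of time. Past the end of a finite orbit this holds because the
default value of `fold` is `lastIdx`, which makes the last index absorbing. -/
theorem fold_fold_add_one (a : ℝ) (k : ℕ) : fold a ((fold a k).1 + 1) = fold a (k + 1) := by
  rcases lt_or_ge (k : ℕ∞) (kap a) with h | h
  · rcases (kap'_structure a).1 with h1 | h1
    · have : fold a k = ⟨k, h1 ▸ h.le⟩ := fold_eq_of_orb_eq h.le rfl
      rw [this]
    · refine fold_eq_of_orb_eq (by simp [h1]) ?_
      rw [orb_fold (by simp [h1])]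
      exact (orb_add_eq (orb_fold h.le) 1).symm
  · have hlt : kap a < ⊤ := h.trans_lt (by simp)
    rw [fold_of_kap_le h, fold_of_kap_le (k := k + 1) (kap_le_of_le h (by omega)),
      fold_of_kap_le]
    rw [← lastIdx_val hlt]; exact_mod_cast Nat.le_succ _

theorem fold_fold_add (a : ℝ) (k n : ℕ) : fold a ((fold a k).1 + n) = fold a (k + n) := by
  induction n with
  | zero => exact fold_coe _
  | succ n ih => rw [← add_assoc, ← fold_fold_add_one, ih, fold_fold_add_one, add_assoc]

theorem fold_lastIdx_add_one {a : ℝ} (h : kap a = ⊤) :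
    (fold a ((lastIdx a).1 + 1)).1 = k0 a := by
  have hle : (((lastIdx a).1 + 1 : ℕ) : ℕ∞) ≤ kap a := by simp [h]
  have hmem : orb a (k0 a) = orb a ((lastIdx a).1 + 1) :=
    Nat.sInf_mem (s := {k : ℕ | orb a k = orb a ((lastIdx a).1 + 1)}) ⟨_, rfl⟩
  have hk0 : k0 a ≤ (fold a ((lastIdx a).1 + 1)).1 := Nat.sInf_le (orb_fold hle)
  have hk0' : (k0 a : ℕ∞) ≤ kap' a :=
    le_trans (Nat.cast_le.2 hk0) (fold a ((lastIdx a).1 + 1)).2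
  have : fold a ((lastIdx a).1 + 1) = ⟨k0 a, hk0'⟩ := fold_eq_of_orb_eq hle hmem
  exact congrArg Subtype.val this

/-- The coefficients `c_k`, set to zero at the end of the orbit of zero. -/
def cz (a p : ℝ) (k : ℕ) : ℝ := open Classical in if (k : ℕ∞) < kap a then cf a p k else 0

theorem cz_of_lt {a p : ℝ} {k : ℕ} (h : (k : ℕ∞) < kap a) : cz a p k = cf a p k := if_pos h

theorem cz_of_le {a p : ℝ} {k : ℕ} (h : kap a ≤ k) : cz a p k = 0 := if_neg (not_lt.2 h)

theorem dlt_congr {a : ℝ} {i j : ℕ} (h : orb a i = orb a j) : dlt a i = dlt a j := by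
  simp [dlt, h]

theorem cz_fold (a p : ℝ) (k : ℕ) : cz a p (fold a k) = cz a p k := by
  rcases lt_or_ge (k : ℕ∞) (kap a) with h | h
  · rcases (kap'_structure a).1 with h1 | h1
    · have : fold a k = ⟨k, h1 ▸ h.le⟩ := fold_eq_of_orb_eq h.le rfl
      rw [this]
    · rw [cz_of_lt h, cz_of_lt (by rw [h1]; simp), cf, cf, dlt_congr (orb_fold h.le)]
  · have hlt : kap a < ⊤ := h.trans_lt (by simp)
    rw [fold_of_kap_le h, cz_of_le h, cz_of_le (lastIdx_val hlt).ge]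

theorem dlt_eq (a : ℝ) (k : ℕ) : dlt a k = 0 ∨ dlt a k = 1 := by
  unfold dlt; split_ifs <;> simp

theorem dlt_nonneg (a : ℝ) (k : ℕ) : 0 ≤ dlt a k := by
  rcases dlt_eq a k with h | h <;> simp [h]

/-! ### The orbit inside the state space: invariance, returns, order. -/

section Range

variable {a : ℝ}

theorem T_of_lt {x : ℝ} (h : x < 1) : T a x = (x + 1) / a := if_pos h

theorem T_of_ge {x : ℝ} (h : 1 ≤ x) : T a x = (x - 1) / a := if_neg (not_lt.2 h)

theorem T_mem_Icc (ha : 1 / 2 < a) (ha' : a ≤ 2 / 3) {x : ℝ}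
    (hx : x ∈ Set.Icc 0 (1 / (1 - a))) (hh : x ∉ hole a) : T a x ∈ Set.Icc 0 (1 / (1 - a)) := by
  have h1 : 0 < 1 - a := by linarith
  have h0 : 0 < a := by linarith
  obtain ⟨hx0, hx1⟩ := hx
  rw [le_div_iff₀ h1] at hx1
  rcases lt_or_ge x 1 with hlt | hge
  · have hx2 : x ≤ (2 * a - 1) / (1 - a) := not_lt.1 fun h => hh ⟨h, hlt⟩
    rw [le_div_iff₀ h1] at hx2
    rw [T_of_lt hlt]
    refine ⟨by positivity, ?_⟩
    rw [div_le_div_iff₀ h0 h1]; linarith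
  · rw [T_of_ge hge]
    refine ⟨div_nonneg (by linarith) h0.le, ?_⟩
    rw [div_le_div_iff₀ h0 h1]; linarith

theorem orb_mem_Icc (ha : 1 / 2 < a) (ha' : a ≤ 2 / 3) {k : ℕ} (hk : (k : ℕ∞) ≤ kap a) :
    orb a k ∈ Set.Icc 0 (1 / (1 - a)) := by
  induction k with
  | zero =>
    have : 0 < 1 - a := by linarith
    exact ⟨le_rfl, by rw [orb_zero]; positivity⟩
  | succ k ih =>
    have hlt : (k : ℕ∞) < kap a := lt_of_lt_of_le (by exact_mod_cast Nat.lt_succ_self k) hk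
    rw [orb_succ]
    exact T_mem_Icc ha ha' (ih hlt.le) (orb_notMem_hole hlt)

theorem zero_lt_kap (ha : 1 / 2 < a) (ha' : a ≤ 2 / 3) : 0 < kap a := by
  rcases kap_cases a with ⟨h, -⟩ | ⟨K, hK, hmem, -⟩
  · rw [h]; simp
  · rw [hK]
    have : K ≠ 0 := by
      rintro rfl
      have h1 : 0 < (2 * a - 1) / (1 - a) := div_pos (by linarith) (by linarith)
      have h2 := hmem.1
      rw [orb_zero] at h2
      linarith
    exact_mod_cast Nat.pos_of_ne_zero this

theorem dlt_zero : dlt a 0 = 1 := by simp [dlt, orb_zero]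

/-- The orbit of zero returns to `[0, 1)` unless it hits the fixed point `1/(1-a)`. -/
theorem exists_orb_lt_one (ha : 1 / 2 < a) (ha' : a ≤ 2 / 3) (hk : kap a = ⊤) {j : ℕ}
    (hj : orb a j ≠ 1 / (1 - a)) : ∃ k, j ≤ k ∧ orb a k < 1 := by
  by_contra! h
  have h0 : 0 < a := by linarith
  have h1 : 0 < 1 - a := by linarith
  have hj' : 0 < 1 / (1 - a) - orb a j :=
    sub_pos.2 (lt_of_le_of_ne (orb_mem_Icc ha ha' (by simp [hk])).2 hj)
  -- The right branch expands the distance to its fixed point `1/(1-a)` by `1/a > 1`, so the orbit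
  -- cannot stay there forever.
  have hstep : ∀ n, 1 / (1 - a) - orb a (j + n) = (1 / (1 - a) - orb a j) * (1 / a) ^ n := by
    intro n
    induction n with
    | zero => simp
    | succ n ih =>
      rw [← add_assoc, orb_succ, T_of_ge (h _ (by omega)), pow_succ, ← mul_assoc, ← ih]
      field_simp
      ring
  have hlim : Tendsto (fun n : ℕ => (1 / (1 - a) - orb a j) * (1 / a) ^ n) atTop atTop :=
    (tendsto_pow_atTop_atTop_of_one_lt (by rw [lt_div_iff₀ h0]; linarith)).const_mul_atTop hj'
  obtain ⟨n, hn⟩ := (hlim.eventually_gt_atTop (1 / (1 - a))).exists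
  rw [← hstep] at hn
  linarith [(orb_mem_Icc ha ha' (k := j + n) (by simp [hk])).1]

theorem orb_one : orb a 1 = 1 / a := by
  rw [orb_succ, orb_zero, T_of_lt one_pos, zero_add]

/-- Supplies a second positive term of the characteristic equation, which is why `λ > p` strictly.
Either the orbit ends in the hole, or it starts from `1/a`, which equals `1/(1-a)` only for `a =
1/2`. -/
theorem exists_return (ha : 1 / 2 < a) (ha' : a ≤ 2 / 3) :
    ∃ k : ℕ, k ≠ 0 ∧ (k : ℕ∞) ≤ kap a ∧ orb a k < 1 := by
  rcases kap_cases a with ⟨h, -⟩ | ⟨K, hK, hmem, -⟩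
  · have h0 : 0 < a := by linarith
    have h1 : 0 < 1 - a := by linarith
    obtain ⟨k, hk, hk'⟩ := exists_orb_lt_one ha ha' h (j := 1) (by
      rw [orb_one]
      intro h2
      rw [div_eq_div_iff h0.ne' h1.ne'] at h2
      linarith)
    exact ⟨k, by omega, by simp [h], hk'⟩
  · refine ⟨K, ?_, hK.ge, hmem.2⟩
    rintro rfl
    have := zero_lt_kap ha ha'
    rw [hK] at this
    simp at this

/-- Zero is the least state and both branches of `T` increase, so the orbit of zero stays weakly to
the left of any later piece as long as the itineraries agree. -/
theorem dlt_lex (ha : 1 / 2 < a) (ha' : a ≤ 2 / 3) (hk : kap a = ⊤) (j n : ℕ)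
    (h : ∀ i < n, dlt a (j + i) = dlt a i) : dlt a (j + n) ≤ dlt a n := by
  have h0 : 0 < a := by linarith
  have hle : orb a n ≤ orb a (j + n) := by
    induction n with
    | zero => rw [orb_zero]; exact (orb_mem_Icc ha ha' (by simp [hk])).1
    | succ n ih =>
      have h1 := ih fun i hi => h i (by omega)
      have h2 := h n (by omega)
      rw [← add_assoc, orb_succ, orb_succ]
      rcases lt_or_ge (orb a n) 1 with hn | hn <;> rcases lt_or_ge (orb a (j + n)) 1 with hj | hj
      · rw [T_of_lt hn, T_of_lt hj]; gcongr
      · simp [dlt, hn, not_lt.2 hj] at h2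
      · simp [dlt, hj, not_lt.2 hn] at h2
      · rw [T_of_ge hn, T_of_ge hj]; gcongr
  unfold dlt
  split_ifs with h1 h2
  · exact le_rfl
  · exact absurd (hle.trans_lt h1) h2
  · exact zero_le_one
  · exact le_rfl

/-- For `a = 2/3` the orbit has to avoid the common endpoint `1` of the two branches. Each step
multiplies the numerator by `3` after adding or subtracting an even number, so it remains odd. -/
theorem exists_odd_numerator (k : ℕ) : ∃ m : ℤ, Odd m ∧ orb (2 / 3) (k + 1) = m / 2 ^ (k + 1) := by
  induction k with
  | zero => exact ⟨3, by decide, by rw [zero_add, orb_one]; norm_num⟩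
  | succ k ih =>
    obtain ⟨m, hm, h⟩ := ih
    have he : Even ((2 : ℤ) ^ (k + 1)) := (even_two).pow_of_ne_zero (by omega)
    rw [orb_succ, h]
    rcases lt_or_ge ((m : ℝ) / 2 ^ (k + 1)) 1 with h1 | h1
    · refine ⟨3 * (m + 2 ^ (k + 1)), (by decide : Odd (3 : ℤ)).mul (hm.add_even he), ?_⟩
      rw [T_of_lt h1, pow_succ _ (k + 1)]; push_cast; field_simp
    · refine ⟨3 * (m - 2 ^ (k + 1)), (by decide : Odd (3 : ℤ)).mul (hm.sub_even he), ?_⟩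
      rw [T_of_ge h1, pow_succ _ (k + 1)]; push_cast; field_simp

theorem orb_two_thirds_ne_one (k : ℕ) : orb (2 / 3) k ≠ 1 := by
  cases k with
  | zero => rw [orb_zero]; norm_num
  | succ k =>
    obtain ⟨m, hm, h⟩ := exists_odd_numerator k
    rw [h]
    intro h1
    rw [div_eq_one_iff_eq (by positivity)] at h1
    have h2 : m = 2 ^ (k + 1) := by exact_mod_cast h1
    have he : Even ((2 : ℤ) ^ (k + 1)) := (even_two).pow_of_ne_zero (by omega)
    rw [← h2] at he
    exact (Int.not_even_iff_odd.2 hm) he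

end Range

/-! ### The characteristic equation -/

theorem occ_succ (a : ℝ) (k : ℕ) : occ a (k + 1) = occ a k + if orb a k < 1 then 1 else 0 := by
  unfold occ
  rw [Finset.range_add_one, Finset.filter_insert]
  split_ifs with h
  · rw [Finset.card_insert_of_notMem (by simp)]
  · rfl

theorem occ_mono (a : ℝ) : Monotone (occ a) := monotone_nat_of_le_succ fun k => by
  rw [occ_succ]; exact Nat.le_add_right _ _

theorem cf_pos {a p : ℝ} (hp : 0 < p) (hp' : p < 1) (k : ℕ) : 0 < cf a p k := by
  unfold cf dlt; split_ifs <;> simp <;> linarith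

theorem cf_le_one {a p : ℝ} (hp : 0 < p) (hp' : p < 1) (k : ℕ) : cf a p k ≤ 1 := by
  unfold cf dlt; split_ifs <;> simp <;> linarith

theorem cz_nonneg {a p : ℝ} (hp : 0 < p) (hp' : p < 1) (k : ℕ) : 0 ≤ cz a p k := by
  unfold cz; split_ifs
  · exact (cf_pos hp hp' k).le
  · exact le_rfl

theorem cz_le_one {a p : ℝ} (hp : 0 < p) (hp' : p < 1) (k : ℕ) : cz a p k ≤ 1 := by
  unfold cz; split_ifs
  · exact cf_le_one hp hp' k
  · exact zero_le_one

theorem prodFrom_cz {a p : ℝ} (hp : 0 < p) (k n : ℕ) (h : ((k + n : ℕ) : ℕ∞) ≤ kap a) :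
    prodFrom (cz a p) k n = p ^ n * ((1 - p) / p) ^ (occ a (k + n) - occ a k) := by
  induction n with
  | zero => simp [prodFrom_zero]
  | succ n ih =>
    have hlt : ((k + n : ℕ) : ℕ∞) < kap a :=
      lt_of_lt_of_le (by exact_mod_cast Nat.lt_succ_self (k + n)) h
    rw [prodFrom_succ, ih hlt.le, cz_of_lt hlt, ← add_assoc, occ_succ]
    have hm := occ_mono a (Nat.le_add_right k n)
    unfold cf dlt
    split_ifs with h1
    · have hpq : p * ((1 - p) / p) = 1 - p := mul_div_cancel₀ _ hp.ne'
      rw [Nat.sub_add_comm hm, pow_succ, pow_succ]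
      linear_combination (-(p ^ n * ((1 - p) / p) ^ (occ a (k + n) - occ a k))) * hpq
    · simp only [add_zero]; ring

theorem prodFrom_cz_eq_zero {a p : ℝ} {k n : ℕ} (h : kap a < ((k + n : ℕ) : ℕ∞))
    (hk : (k : ℕ∞) ≤ kap a) : prodFrom (cz a p) k n = 0 := by
  obtain ⟨K, hK⟩ := ENat.ne_top_iff_exists.1 (h.trans_le le_top).ne
  rw [← hK, Nat.cast_lt] at h
  rw [← hK, Nat.cast_le] at hk
  refine Finset.prod_eq_zero (i := K - k) (Finset.mem_range.2 (by omega)) ?_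
  rw [Nat.add_sub_cancel' hk]
  exact cz_of_le hK.symm.le

/-- The renewal mass created at age `n`. -/
def birth (a p : ℝ) (n : ℕ) : ℝ := p * dlt a (fold a n) * prodFrom (cz a p) 0 n

/-- The survival factors normalized by `λ`. -/
def rat (a p lam : ℝ) (k : ℕ) : ℝ := cz a p k / lam

theorem dlt_fold {a : ℝ} {k : ℕ} (h : (k : ℕ∞) ≤ kap a) : dlt a (fold a k) = dlt a k :=
  dlt_congr (orb_fold h)

theorem birth_zero (a p : ℝ) : birth a p 0 = p := by
  rw [birth, dlt_fold (by simp), dlt_zero, prodFrom_zero, mul_one, mul_one]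

theorem birth_div (a p lam : ℝ) (n : ℕ) : birth a p n / lam ^ (n + 1) =
    p / lam * dlt a (fold a n) * prodFrom (rat a p lam) 0 n := by
  have : rat a p lam = fun k => cz a p k / lam := rfl
  rw [birth, this, prodFrom_div, pow_succ']
  simp only [div_eq_mul_inv, mul_inv]
  ring

theorem birth_nonneg {a p : ℝ} (hp : 0 < p) (hp' : p < 1) (n : ℕ) : 0 ≤ birth a p n :=
  mul_nonneg (mul_nonneg hp.le (dlt_nonneg _ _)) (prodFrom_nonneg (cz_nonneg hp hp') _ _)

theorem birth_le_one {a p : ℝ} (hp : 0 < p) (hp' : p < 1) (n : ℕ) : birth a p n ≤ 1 := by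
  have h1 : prodFrom (cz a p) 0 n ≤ 1 :=
    Finset.prod_le_one (fun _ _ => cz_nonneg hp hp' _) fun _ _ => cz_le_one hp hp' _
  have h2 : dlt a (fold a n) ≤ 1 := (le_abs_self _).trans (abs_dlt_le _ _)
  exact mul_le_one₀ (mul_le_one₀ hp'.le (dlt_nonneg _ _) h2)
    (prodFrom_nonneg (cz_nonneg hp hp') _ _) h1

/-- A finite orbit needs no separate treatment: the survival product vanishes past the hole, so the
sum extends by zero to all of `ℕ`. -/
theorem charEq_iff {a p lam : ℝ} (hp : 0 < p) :
    CharEq a p lam ↔ HasSum (fun n => birth a p n / lam ^ (n + 1)) 1 := by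
  rw [CharEq, ← Function.Injective.hasSum_iff
    (Subtype.val_injective (p := fun k : ℕ => (k : ℕ∞) ≤ kap a))]
  · refine iff_of_eq (congrArg (fun f => HasSum f 1) (funext fun k => ?_))
    have h : ((0 + k.1 : ℕ) : ℕ∞) ≤ kap a := by rw [zero_add]; exact k.2
    have h0 : occ a 0 = 0 := rfl
    simp only [Function.comp_apply, birth]
    rw [prodFrom_cz hp _ _ h, dlt_fold k.2, h0, zero_add, Nat.sub_zero, div_pow]
    ring
  · intro n hn
    have h : kap a < ((0 + n : ℕ) : ℕ∞) := by
      rw [zero_add]; exact not_le.1 fun h => hn ⟨⟨n, h⟩, rfl⟩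
    rw [birth, prodFrom_cz_eq_zero h (by simp)]
    simp

/-- The properties of the leading eigenvalue `λ`: it solves the characteristic equation, and the
normalized survival products decay geometrically. -/
structure IsPersistence (a p lam : ℝ) : Prop where
  p_pos : 0 < p
  p_lt_one : p < 1
  p_lt : p < lam
  hasSum : HasSum (fun n => p / lam * dlt a (fold a n) * prodFrom (rat a p lam) 0 n) 1
  decay : ∃ C : ℝ, ∃ γ ∈ Set.Ioo (0 : ℝ) 1, ∀ j n, prodFrom (rat a p lam) j n ≤ C * γ ^ n

theorem rat_nonneg {a p lam : ℝ} (hp : 0 < p) (hp' : p < 1) (hlam : 0 < lam) (k : ℕ) :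
    0 ≤ rat a p lam k := div_nonneg (cz_nonneg hp hp' k) hlam.le

/-- Only partial sums at most one are assumed, so this applies to trial values in the search for `λ`
as well as to `λ` itself. An infinite orbit uses the lexicographic argument; on a finite one the
products vanish after the hole. -/
theorem rat_decay {a p lam : ℝ} (ha : 1 / 2 < a) (ha' : a ≤ 2 / 3) (hp : 0 < p) (hp' : p < 1)
    (hlam : p < lam) (h : ∀ N, ∑ n ∈ Finset.range N, birth a p n / lam ^ (n + 1) ≤ 1) :
    ∃ C : ℝ, ∃ γ ∈ Set.Ioo (0 : ℝ) 1, ∀ j n, prodFrom (rat a p lam) j n ≤ C * γ ^ n := by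
  have hl0 : 0 < lam := hp.trans hlam
  rcases kap_cases a with ⟨hk, -⟩ | ⟨K, hK, -⟩
  · have hx : 0 < p / lam := div_pos hp hl0
    have hQ : 0 < (1 - p) / lam := div_pos (by linarith) hl0
    have hdr : ∀ i, (dlt a i = 1 ∧ rat a p lam i = (1 - p) / lam) ∨
        (dlt a i = 0 ∧ rat a p lam i = p / lam) := fun i => by
      rw [rat, cz_of_lt (by simp [hk]), cf]
      rcases dlt_eq a i with h | h
      · right; simp [h]
      · left; simp [h]
    refine prodFrom_decay hx ((div_lt_one hl0).2 hlam) hQ hdr ?_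
    refine fun N j => massFrom_le_one hx hQ hdr (dlt_lex ha ha' hk) (fun N => ?_) N j
    refine le_trans (le_of_eq (Finset.sum_congr rfl fun n _ => ?_)) (h N)
    rw [birth_div, zero_add, dlt_fold (by simp [hk])]
  · refine prodFrom_decay_of_eq_zero (R := 1 / lam) (K := K) (rat_nonneg hp hp' hl0)
      (fun i => ?_) fun i hi => ?_
    · exact div_le_div_of_nonneg_right (cz_le_one hp hp' i) hl0.le
    · rw [rat, cz_of_le (by rw [hK]; exact_mod_cast hi), zero_div]

theorem exists_persistence {a p : ℝ} (ha : 1 / 2 < a) (ha' : a ≤ 2 / 3) (hp : 0 < p)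
    (hp' : p < 1) :
    ∃ lam, IsPersistence a p lam ∧ CharEq a p lam ∧ ∀ μ, 0 < μ → CharEq a p μ → μ = lam := by
  obtain ⟨lam, h1, h2, h3⟩ := exists_unique_renewal_root (b := birth a p) (birth_nonneg hp hp')
    (birth_le_one hp hp') (by rwa [birth_zero]) (by
      obtain ⟨k, hk0, hk, hk1⟩ := exists_return ha ha'
      refine ⟨k, hk0, mul_pos (mul_pos hp ?_) (Finset.prod_pos fun i hi => ?_)⟩
      · rw [dlt_fold hk, dlt, if_pos hk1]; exact one_pos
      · rw [zero_add, cz_of_lt (lt_of_lt_of_le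
          (by exact_mod_cast Finset.mem_range.1 hi) hk)]
        exact cf_pos hp hp' i) (by
      intro l hl h
      rw [birth_zero] at hl
      have hl0 : 0 < l := hp.trans hl
      obtain ⟨C, γ, hγ, hC⟩ := rat_decay ha ha' hp hp' hl h
      refine ⟨C, γ, hγ, fun n => ?_⟩
      rw [birth_div]
      refine le_trans (mul_le_of_le_one_left (prodFrom_nonneg (rat_nonneg hp hp' hl0) _ _)
        (mul_le_one₀ ((div_le_one hl0).2 hl.le) (dlt_nonneg _ _)
          ((le_abs_self _).trans (abs_dlt_le _ _)))) (hC 0 n))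
  rw [birth_zero] at h1
  refine ⟨lam, ⟨hp, hp', h1, by simpa only [birth_div] using h2, ?_⟩, (charEq_iff hp).2 h2,
    fun μ hμ h => h3 μ hμ ((charEq_iff hp).1 h)⟩
  exact rat_decay ha ha' hp hp' h1 fun N => sum_le_hasSum _ (fun n _ =>
    div_nonneg (birth_nonneg hp hp' n) (pow_pos (hp.trans h1) _).le) h2

/-! ### Reproductive values, the coordinates of the left eigenvector. -/

section Ages

variable {a p lam : ℝ}

theorem IsPersistence.lam_pos (h : IsPersistence a p lam) : 0 < lam := h.p_pos.trans h.p_lt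

theorem IsPersistence.rat_nonneg (h : IsPersistence a p lam) (k : ℕ) : 0 ≤ rat a p lam k :=
  KilledAR.rat_nonneg h.p_pos h.p_lt_one h.lam_pos k

/-- The terms of `v*_j`. -/
def ageTerm (a p lam : ℝ) (j n : ℕ) : ℝ :=
  p / lam * dlt a (fold a (j + n)) * prodFrom (rat a p lam) j n

/-- The reproductive value `v*_j` of the age `j`. -/
def ageValue (a p lam : ℝ) (j : ℕ) : ℝ := ∑' n, ageTerm a p lam j n

theorem IsPersistence.ageTerm_nonneg (h : IsPersistence a p lam) (j n : ℕ) :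
    0 ≤ ageTerm a p lam j n :=
  mul_nonneg (mul_nonneg (div_nonneg h.p_pos.le h.lam_pos.le) (dlt_nonneg _ _))
    (prodFrom_nonneg h.rat_nonneg _ _)

theorem IsPersistence.ageTerm_le (h : IsPersistence a p lam) (j n : ℕ) :
    ageTerm a p lam j n ≤ prodFrom (rat a p lam) j n :=
  mul_le_of_le_one_left (prodFrom_nonneg h.rat_nonneg _ _)
    (mul_le_one₀ ((div_le_one h.lam_pos).2 h.p_lt.le) (dlt_nonneg _ _)
      ((le_abs_self _).trans (abs_dlt_le _ _)))

theorem IsPersistence.summable_prodFrom (h : IsPersistence a p lam) (j : ℕ) :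
    Summable fun n => prodFrom (rat a p lam) j n := by
  obtain ⟨C, γ, hγ, hC⟩ := h.decay
  exact Summable.of_nonneg_of_le (fun n => prodFrom_nonneg h.rat_nonneg _ _) (hC j)
    ((summable_geometric_of_lt_one hγ.1.le hγ.2).mul_left C)

theorem IsPersistence.summable_ageTerm (h : IsPersistence a p lam) (j : ℕ) :
    Summable fun n => ageTerm a p lam j n :=
  Summable.of_nonneg_of_le (h.ageTerm_nonneg j) (h.ageTerm_le j) (h.summable_prodFrom j)

theorem IsPersistence.ageValue_nonneg (h : IsPersistence a p lam) (j : ℕ) :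
    0 ≤ ageValue a p lam j := tsum_nonneg (h.ageTerm_nonneg j)

theorem IsPersistence.exists_ageValue_le (h : IsPersistence a p lam) :
    ∃ C : ℝ, ∀ j, ageValue a p lam j ≤ C := by
  obtain ⟨C, γ, hγ, hC⟩ := h.decay
  refine ⟨∑' n, C * γ ^ n, fun j => (h.summable_ageTerm j).tsum_le_tsum
    (fun n => (h.ageTerm_le j n).trans (hC j n))
    ((summable_geometric_of_lt_one hγ.1.le hγ.2).mul_left C)⟩

theorem IsPersistence.ageValue_zero (h : IsPersistence a p lam) : ageValue a p lam 0 = 1 := by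
  rw [← h.hasSum.tsum_eq]
  exact tsum_congr fun n => by rw [ageTerm, zero_add]

theorem rat_fold (a p lam : ℝ) (k : ℕ) : rat a p lam (fold a k) = rat a p lam k := by
  rw [rat, rat, cz_fold]

theorem rat_fold_add (a p lam : ℝ) (k n : ℕ) :
    rat a p lam ((fold a k).1 + n) = rat a p lam (k + n) := by
  rw [← rat_fold, fold_fold_add, rat_fold]

theorem prodFrom_fold (a p lam : ℝ) (k n : ℕ) :
    prodFrom (rat a p lam) (fold a k) n = prodFrom (rat a p lam) k n :=
  prodFrom_congr fun i _ => rat_fold_add a p lam k i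

/-- The value depends on the orbit point alone, so in the periodic case the infinite sum over time
is a well-defined function on finitely many indices. -/
theorem ageValue_fold (a p lam : ℝ) (k : ℕ) :
    ageValue a p lam (fold a k) = ageValue a p lam k :=
  tsum_congr fun n => by rw [ageTerm, ageTerm, prodFrom_fold, fold_fold_add]

/-- First-step decomposition: births now, plus the discounted value at the next age. Together with
`ageValue_zero` this is the left eigenvector equation. -/
theorem IsPersistence.ageValue_eq (h : IsPersistence a p lam) (j : ℕ) :
    ageValue a p lam j =
      p / lam * dlt a (fold a j) + rat a p lam j * ageValue a p lam (j + 1) := by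
  rw [ageValue, (h.summable_ageTerm j).tsum_eq_zero_add]
  congr 1
  · rw [ageTerm, prodFrom_zero, mul_one, add_zero]
  · rw [ageValue, ← tsum_mul_left]
    refine tsum_congr fun n => ?_
    rw [ageTerm, ageTerm, prodFrom_succ', add_assoc j 1 n, add_comm 1 n]; ring

theorem IsPersistence.isVStarCoord (h : IsPersistence a p lam) {k : ℕ} (hk : (k : ℕ∞) ≤ kap a) :
    IsVStarCoord a p lam k (ageValue a p lam k) := by
  have hinj : Function.Injective
      fun n : {n : ℕ // k ≤ n ∧ (n : ℕ∞) ≤ kap a} => n.1 - k := fun m n hmn =>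
    Subtype.ext (by have h1 := m.2.1; have h2 := n.2.1; simp only at hmn; omega)
  have h1 := (hinj.hasSum_iff (f := fun n => ageTerm a p lam k n) ?_).2
    (h.summable_ageTerm k).hasSum
  · refine h1.congr_fun fun n => ?_
    obtain ⟨m, hm⟩ := Nat.exists_eq_add_of_le n.2.1
    have hle : ((k + m : ℕ) : ℕ∞) ≤ kap a := hm ▸ n.2.2
    have hr : rat a p lam = fun k => cz a p k / lam := rfl
    simp only [Function.comp_apply, hm, Nat.add_sub_cancel_left]
    rw [ageTerm, dlt_fold hle, hr, prodFrom_div, prodFrom_cz h.p_pos k m hle, pow_succ', div_pow]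
    ring
  · intro n hn
    have hlt : kap a < ((k + n : ℕ) : ℕ∞) := by
      by_contra hle
      exact hn ⟨⟨k + n, Nat.le_add_right _ _, not_lt.1 hle⟩, Nat.add_sub_cancel_left _ _⟩
    have hr : rat a p lam = fun k => cz a p k / lam := rfl
    rw [ageTerm, hr, prodFrom_div, prodFrom_cz_eq_zero hlt hk]
    simp

theorem prodFrom_rat_eq_vCoord (hp : 0 < p) {k : ℕ} (hk : (k : ℕ∞) ≤ kap a) :
    prodFrom (rat a p lam) 0 k = vCoord a p lam k := by
  have hr : rat a p lam = fun k => cz a p k / lam := rfl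
  have h0 : occ a 0 = 0 := rfl
  rw [hr, prodFrom_div, prodFrom_cz hp 0 k (by rwa [zero_add]), zero_add, h0, Nat.sub_zero,
    vCoord, div_pow]
  ring

theorem prodFrom_rat_eq_zero {k : ℕ} (hk : kap a < k) : prodFrom (rat a p lam) 0 k = 0 := by
  have hr : rat a p lam = fun k => cz a p k / lam := rfl
  rw [hr, prodFrom_div, prodFrom_cz_eq_zero (by rwa [zero_add]) (by simp), zero_div]

end Ages

/-! ### Operators on the sequence space -/

section Lift

variable {𝕜 : Type} [RCLike 𝕜] {a : ℝ} {F : Type*} [NormedAddCommGroup F] [NormedSpace 𝕜 F]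

theorem basisVec_apply (j k : Idx a) : basisVec 𝕜 j k = if k = j then 1 else 0 := by
  rw [basisVec]
  split_ifs with h
  · rw [h, lp.single_apply_self]
  · rw [lp.single_apply_ne _ _ _ h]

theorem norm_basisVec (j : Idx a) : ‖basisVec 𝕜 j‖ = 1 := by
  simp [basisVec]

theorem hasSum_basisVec (u : L1 𝕜 a) : HasSum (fun k => u k • basisVec 𝕜 k) u := by
  have h := lp.hasSum_single (p := 1) (by simp) u
  refine h.congr_fun fun k => ?_
  rw [basisVec, ← lp.single_smul]; simp

theorem clm_ext {A B : L1 𝕜 a →L[𝕜] F} (h : ∀ j, A (basisVec 𝕜 j) = B (basisVec 𝕜 j)) : A = B := by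
  ext u
  have h1 := (hasSum_basisVec u).mapL A
  have h2 := (hasSum_basisVec u).mapL B
  simp only [map_smul, h] at h1 h2
  exact h1.unique h2

/-- On `ℓ₁` column bounds control the operator norm; hence decay of the survival products uniform in
the age is decay of `‖S^n‖`. -/
theorem clm_norm_le {A : L1 𝕜 a →L[𝕜] F} {C : ℝ} (hC : 0 ≤ C) (h : ∀ j, ‖A (basisVec 𝕜 j)‖ ≤ C) :
    ‖A‖ ≤ C := by
  refine A.opNorm_le_bound hC fun u => ?_
  have h1 := (hasSum_basisVec u).mapL A
  rw [L1.norm_eq, ← tsum_mul_left, ← h1.tsum_eq]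
  refine tsum_of_norm_bounded ((L1.summable_norm u).mul_left C).hasSum fun k => ?_
  rw [map_smul, norm_smul, mul_comm]
  exact mul_le_mul_of_nonneg_right (h k) (norm_nonneg _)

variable [CompleteSpace F]

theorem summable_lift {x : Idx a → F} {C : ℝ} (hx : ∀ k, ‖x k‖ ≤ C) (u : L1 𝕜 a) :
    Summable fun k => u k • x k :=
  Summable.of_norm_bounded ((L1.summable_norm u).mul_right C) fun k => by
    rw [norm_smul]; exact mul_le_mul_of_nonneg_left (hx k) (norm_nonneg _)

/-- The bounded operator `u ↦ ∑ u_k x_k` given by a bounded family of vectors. -/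
def l1Lift (𝕜 : Type) [RCLike 𝕜] [NormedSpace 𝕜 F] (x : Idx a → F) (C : ℝ) (hx : ∀ k, ‖x k‖ ≤ C) :
    L1 𝕜 a →L[𝕜] F :=
  LinearMap.mkContinuous
    { toFun := fun u => ∑' k, u k • x k
      map_add' := fun u w => by
        simp only [lp.coeFn_add, Pi.add_apply, add_smul]
        exact (summable_lift hx u).tsum_add (summable_lift hx w)
      map_smul' := fun c u => by
        simp only [lp.coeFn_smul, Pi.smul_apply, smul_eq_mul, mul_smul, RingHom.id_apply]
        exact (summable_lift hx u).tsum_const_smul c } C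
    (fun u => by
      rw [L1.norm_eq, ← tsum_mul_left]
      refine tsum_of_norm_bounded ((L1.summable_norm u).mul_left C).hasSum fun k => ?_
      rw [norm_smul, mul_comm]
      exact mul_le_mul_of_nonneg_right (hx k) (norm_nonneg _))

theorem l1Lift_basisVec (x : Idx a → F) (C : ℝ) (hx : ∀ k, ‖x k‖ ≤ C) (j : Idx a) :
    l1Lift 𝕜 x C hx (basisVec 𝕜 j) = x j := by
  change ∑' k, basisVec 𝕜 j k • x k = x j
  rw [tsum_eq_single j fun k hk => by rw [basisVec_apply, if_neg hk, zero_smul],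
    basisVec_apply, if_pos rfl, one_smul]

end Lift

/-- The index of the starting point of the orbit. -/
def zeroIdx (a : ℝ) : Idx a := ⟨0, by simp⟩

theorem fold_zero (a : ℝ) : fold a 0 = zeroIdx a := fold_coe (zeroIdx a)

/-- The action on the coordinate vectors that `A` and `Â` have in common. -/
def IsRenewalOp (𝕜 : Type) [RCLike 𝕜] (a p : ℝ) (B : L1 𝕜 a →L[𝕜] L1 𝕜 a) : Prop :=
  ∀ j : Idx a, B (basisVec 𝕜 j) = ((p * dlt a j : ℝ) : 𝕜) • basisVec 𝕜 (zeroIdx a)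
    + ((cz a p j : ℝ) : 𝕜) • basisVec 𝕜 (fold a (j + 1))

section Action

variable {𝕜 : Type} [RCLike 𝕜] {a p : ℝ}

theorem opA_basisVec_apply (j k : Idx a) : opA 𝕜 a p (basisVec 𝕜 j) k =
    if k.1 = 0 then ((p * dlt a j : ℝ) : 𝕜)
    else if k.1 = j.1 + 1 then ((cf a p j : ℝ) : 𝕜) else 0 := by
  rw [opA_apply]
  split_ifs with h0 h1
  · rw [tsum_eq_single j fun i hi => by rw [basisVec_apply, if_neg hi, mul_zero],
      basisVec_apply, if_pos rfl]
    push_cast; ring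
  · have h2 : prevIdx k = j := Subtype.ext (by simp [prevIdx, h1])
    rw [basisVec_apply, if_pos h2, h1, Nat.add_sub_cancel, mul_one]
  · have h2 : prevIdx k ≠ j := fun h => h1 (by
      have := congrArg Subtype.val h
      simp only [prevIdx] at this
      omega)
    rw [basisVec_apply, if_neg h2, mul_zero]

theorem renewal_rhs_apply (j k : Idx a) : (((p * dlt a j : ℝ) : 𝕜) • basisVec 𝕜 (zeroIdx a)
    + ((cz a p j : ℝ) : 𝕜) • basisVec 𝕜 (fold a (j + 1)) : L1 𝕜 a) k =
    (if k.1 = 0 then ((p * dlt a j : ℝ) : 𝕜) else 0)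
      + if k.1 = (fold a (j + 1)).1 then ((cz a p j : ℝ) : 𝕜) else 0 := by
  rw [lp.coeFn_add, Pi.add_apply, lp.coeFn_smul, lp.coeFn_smul, Pi.smul_apply, Pi.smul_apply,
    basisVec_apply, basisVec_apply]
  congr 1 <;> simp only [Subtype.ext_iff, smul_eq_mul, mul_ite, mul_one, mul_zero, zeroIdx]

theorem isRenewalOp_opA (h : Aperiodic a) : IsRenewalOp 𝕜 a p (opA 𝕜 a p) := by
  intro j
  ext k
  rw [opA_basisVec_apply, renewal_rhs_apply]
  rcases lt_or_ge (j.1 : ℕ∞) (kap a) with hj | hj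
  · have hle : ((j.1 + 1 : ℕ) : ℕ∞) ≤ kap' a :=
      le_trans (by exact_mod_cast Order.add_one_le_of_lt hj) h.le
    have hf : (fold a (j.1 + 1)).1 = j.1 + 1 :=
      congrArg Subtype.val (fold_coe (⟨j.1 + 1, hle⟩ : Idx a))
    rw [hf, cz_of_lt hj]
    by_cases h0 : k.1 = 0
    · simp [h0]
    · simp [h0]
  -- The last index of a finite orbit: the shift leaves the index set, in agreement with `cz = 0`.
  · have hk : k.1 ≠ j.1 + 1 := fun hk => by
      have h1 := k.le_kap.trans hj
      rw [hk, Nat.cast_le] at h1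
      omega
    simp [hk, cz_of_le hj]

/-- The extra term of `Â` closes the loop: it sends the last index to `k0`, the fold of its
successor. -/
theorem isRenewalOp_opAhat (h : EventuallyPeriodic a) : IsRenewalOp 𝕜 a p (opAhat 𝕜 a p) := by
  intro j
  ext k
  rw [opAhat_apply, opA_basisVec_apply, renewal_rhs_apply, basisVec_apply]
  have hlast : ((lastIdx a).1 : ℕ∞) = kap' a := by
    simp [lastIdx, ENat.natCast_toNat h.1.ne]
  rw [cz_of_lt (by simp [h.2])]
  by_cases hj : lastIdx a = j
  · subst hj
    have hk : k.1 ≠ (lastIdx a).1 + 1 := fun hk => by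
      have h1 := Nat.cast_le.1 (k.2.trans hlast.ge)
      omega
    rw [fold_lastIdx_add_one h.2]
    simp [hk]
  · have hlt : j.1 < (lastIdx a).1 :=
      lt_of_le_of_ne (Nat.cast_le.1 (j.2.trans hlast.ge)) fun h => hj (Subtype.ext h.symm)
    have hle : ((j.1 + 1 : ℕ) : ℕ∞) ≤ kap' a := (Nat.cast_le.2 hlt).trans hlast.le
    have hf : (fold a (j.1 + 1)).1 = j.1 + 1 :=
      congrArg Subtype.val (fold_coe (⟨j.1 + 1, hle⟩ : Idx a))
    rw [hf, if_neg hj]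
    by_cases h0 : k.1 = 0
    · simp [h0]
    · simp [h0]

end Action

/-! ### The embedding of real into complex sequences -/

/-- The embedding of real sequences into complex sequences. -/
def toComplex (a : ℝ) : L1 ℝ a →ₗᵢ[ℝ] L1 ℂ a where
  toFun u := ⟨fun k => (u k : ℂ), by
    have h := L1.summable_norm u
    exact memℓp_gen (by simpa using h)⟩
  map_add' u w := by ext k; exact Complex.ofReal_add _ _
  map_smul' c u := by ext k; exact (Complex.ofReal_mul _ _).trans Complex.real_smul.symm
  norm_map' u := by
    rw [L1.norm_eq, L1.norm_eq]
    exact tsum_congr fun k => Complex.norm_real _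

theorem toComplex_apply {a : ℝ} (u : L1 ℝ a) (k : Idx a) : toComplex a u k = (u k : ℂ) := rfl

theorem toComplex_basisVec {a : ℝ} (j : Idx a) : toComplex a (basisVec ℝ j) = basisVec ℂ j := by
  ext k
  rw [toComplex_apply, basisVec_apply, basisVec_apply]
  split_ifs <;> simp

theorem toComplex_smul {a : ℝ} (c : ℝ) (u : L1 ℝ a) :
    toComplex a (c • u) = (c : ℂ) • toComplex a u := by
  ext k; exact Complex.ofReal_mul _ _

theorem toComplex_comm {a p : ℝ} {B : L1 ℝ a →L[ℝ] L1 ℝ a} {B' : L1 ℂ a →L[ℂ] L1 ℂ a}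
    (hB : IsRenewalOp ℝ a p B) (hB' : IsRenewalOp ℂ a p B') (u : L1 ℝ a) :
    B' (toComplex a u) = toComplex a (B u) := by
  have h : (B'.restrictScalars ℝ).comp (toComplex a).toContinuousLinearMap =
      (toComplex a).toContinuousLinearMap.comp B := clm_ext fun j => by
    change B' (toComplex a (basisVec ℝ j)) = toComplex a (B (basisVec ℝ j))
    rw [toComplex_basisVec, hB', hB, map_add, toComplex_smul, toComplex_smul, toComplex_basisVec,
      toComplex_basisVec]
    simp
  exact congrArg (fun A => A u) h

/-! ### The spectral gap -/

section Parts

variable {𝕜 : Type} [RCLike 𝕜] {a p lam : ℝ}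

theorem norm_birthCoeff_le (a p lam : ℝ) (j : Idx a) :
    ‖((p / lam * dlt a j : ℝ) : 𝕜)‖ ≤ |p / lam| := by
  rw [RCLike.norm_ofReal, abs_mul]
  exact mul_le_of_le_one_right (abs_nonneg _) (abs_dlt_le a j)

/-- The normalized birth functional `u ↦ (p / λ) ∑ δ_k u_k`. -/
def birthCLM (𝕜 : Type) [RCLike 𝕜] (a p lam : ℝ) : L1 𝕜 a →L[𝕜] 𝕜 :=
  l1Lift 𝕜 (fun j : Idx a => ((p / lam * dlt a j : ℝ) : 𝕜)) |p / lam| (norm_birthCoeff_le a p lam)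

theorem birthCLM_basisVec (j : Idx a) :
    birthCLM 𝕜 a p lam (basisVec 𝕜 j) = ((p / lam * dlt a j : ℝ) : 𝕜) := l1Lift_basisVec _ _ _ j

/-- The normalized aging part of a renewal operator. -/
def agingCLM (p lam : ℝ) (B : L1 𝕜 a →L[𝕜] L1 𝕜 a) : L1 𝕜 a →L[𝕜] L1 𝕜 a :=
  (lam : 𝕜)⁻¹ • B - (birthCLM 𝕜 a p lam).smulRight (basisVec 𝕜 (zeroIdx a))

theorem smul_eq_agingCLM_add (B : L1 𝕜 a →L[𝕜] L1 𝕜 a) (u : L1 𝕜 a) :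
    ((lam : 𝕜)⁻¹ • B) u = agingCLM p lam B u + birthCLM 𝕜 a p lam u • basisVec 𝕜 (zeroIdx a) := by
  have : agingCLM p lam B u =
      ((lam : 𝕜)⁻¹ • B) u - birthCLM 𝕜 a p lam u • basisVec 𝕜 (zeroIdx a) := rfl
  rw [this, sub_add_cancel]

theorem agingCLM_basisVec {B : L1 𝕜 a →L[𝕜] L1 𝕜 a} (hB : IsRenewalOp 𝕜 a p B) (j : Idx a) :
    agingCLM p lam B (basisVec 𝕜 j) =
      ((rat a p lam j : ℝ) : 𝕜) • basisVec 𝕜 (fold a (j + 1)) := by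
  have : agingCLM p lam B (basisVec 𝕜 j) = (lam : 𝕜)⁻¹ • B (basisVec 𝕜 j)
      - birthCLM 𝕜 a p lam (basisVec 𝕜 j) • basisVec 𝕜 (zeroIdx a) := rfl
  rw [this, hB, birthCLM_basisVec, smul_add, smul_smul, smul_smul, rat]
  have h1 : (lam : 𝕜)⁻¹ * ((p * dlt a j : ℝ) : 𝕜) = ((p / lam * dlt a j : ℝ) : 𝕜) := by
    push_cast; ring
  have h2 : (lam : 𝕜)⁻¹ * ((cz a p j : ℝ) : 𝕜) = ((cz a p j / lam : ℝ) : 𝕜) := by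
    push_cast; ring
  rw [h1, h2]; abel

theorem agingCLM_pow_basisVec {B : L1 𝕜 a →L[𝕜] L1 𝕜 a} (hB : IsRenewalOp 𝕜 a p B) (n : ℕ)
    (j : Idx a) : (agingCLM p lam B ^ n) (basisVec 𝕜 j) =
      ((prodFrom (rat a p lam) j n : ℝ) : 𝕜) • basisVec 𝕜 (fold a (j + n)) := by
  induction n with
  | zero => simp [prodFrom_zero, fold_coe]
  | succ n ih =>
    have h1 : (agingCLM p lam B ^ (n + 1)) (basisVec 𝕜 j) =
        agingCLM p lam B ((agingCLM p lam B ^ n) (basisVec 𝕜 j)) := by rw [pow_succ']; rfl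
    rw [h1, ih, map_smul, agingCLM_basisVec hB, smul_smul, rat_fold, fold_fold_add_one,
      prodFrom_succ, RCLike.ofReal_mul, add_assoc]

variable (h : IsPersistence a p lam)
include h

theorem IsPersistence.exists_aging_decay {B : L1 𝕜 a →L[𝕜] L1 𝕜 a} (hB : IsRenewalOp 𝕜 a p B) :
    ∃ C : ℝ, ∃ γ ∈ Set.Ioo (0 : ℝ) 1, ∀ n, ‖agingCLM p lam B ^ n‖ ≤ C * γ ^ n := by
  obtain ⟨C, γ, hγ, hC⟩ := h.decay
  refine ⟨C, γ, hγ, fun n => clm_norm_le ?_ fun j => ?_⟩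
  · exact (prodFrom_nonneg h.rat_nonneg 0 n).trans (hC 0 n)
  · rw [agingCLM_pow_basisVec hB, norm_smul, norm_basisVec, mul_one, RCLike.norm_ofReal,
      abs_of_nonneg (prodFrom_nonneg h.rat_nonneg _ _)]
    exact hC _ _

theorem IsPersistence.summable_rightVec :
    Summable fun n => ((prodFrom (rat a p lam) 0 n : ℝ) : 𝕜) • basisVec 𝕜 (fold a n) := by
  refine Summable.of_norm_bounded (h.summable_prodFrom 0) fun n => ?_
  rw [norm_smul, norm_basisVec, mul_one, RCLike.norm_ofReal,
    abs_of_nonneg (prodFrom_nonneg h.rat_nonneg _ _)]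

omit h in
/-- The right eigenvector, the stationary distribution of ages. -/
def rightVec (𝕜 : Type) [RCLike 𝕜] (a p lam : ℝ) : L1 𝕜 a :=
  ∑' n, ((prodFrom (rat a p lam) 0 n : ℝ) : 𝕜) • basisVec 𝕜 (fold a n)

theorem IsPersistence.hasSum_rightVec :
    HasSum (fun n => ((prodFrom (rat a p lam) 0 n : ℝ) : 𝕜) • basisVec 𝕜 (fold a n))
      (rightVec 𝕜 a p lam) := h.summable_rightVec.hasSum

/-- `rightVec` is the Neumann series `∑ S^n e_0`, so the difference telescopes. -/
theorem IsPersistence.rightVec_sub {B : L1 𝕜 a →L[𝕜] L1 𝕜 a} (hB : IsRenewalOp 𝕜 a p B) :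
    rightVec 𝕜 a p lam - agingCLM p lam B (rightVec 𝕜 a p lam) = basisVec 𝕜 (zeroIdx a) := by
  have h1 := (h.hasSum_rightVec (𝕜 := 𝕜)).mapL (agingCLM p lam B)
  simp only [map_smul, agingCLM_basisVec hB, smul_smul, rat_fold, fold_fold_add_one,
    ← RCLike.ofReal_mul] at h1
  have h2 : ∀ n, prodFrom (rat a p lam) 0 n * rat a p lam n = prodFrom (rat a p lam) 0 (n + 1) :=
    fun n => by rw [prodFrom_succ, zero_add]
  simp only [h2] at h1
  rw [← h1.tsum_eq, rightVec, (h.summable_rightVec (𝕜 := 𝕜)).tsum_eq_zero_add,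
    add_sub_cancel_right, prodFrom_zero, fold_zero]
  simp

theorem IsPersistence.birthCLM_rightVec : birthCLM 𝕜 a p lam (rightVec 𝕜 a p lam) = 1 := by
  have h1 := (h.hasSum_rightVec (𝕜 := 𝕜)).mapL (birthCLM 𝕜 a p lam)
  have h2 : HasSum (fun n => ((p / lam * dlt a (fold a n) * prodFrom (rat a p lam) 0 n : ℝ) : 𝕜))
      ((1 : ℝ) : 𝕜) := RCLike.hasSum_ofReal _ |>.2 h.hasSum
  rw [RCLike.ofReal_one] at h2
  refine h1.unique (h2.congr_fun fun n => ?_)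
  rw [map_smul, birthCLM_basisVec, smul_eq_mul, ← RCLike.ofReal_mul, mul_comm]

/-- The left eigenvector `v*`. -/
def IsPersistence.leftVec : Linf a :=
  ⟨fun j => ageValue a p lam j, by
    obtain ⟨C, hC⟩ := h.exists_ageValue_le
    refine memℓp_infty ⟨C, ?_⟩
    rintro _ ⟨j, rfl⟩
    simpa only [Real.norm_of_nonneg (h.ageValue_nonneg _)] using hC j⟩

theorem IsPersistence.leftVec_apply (j : Idx a) : h.leftVec j = ageValue a p lam j := rfl

theorem IsPersistence.norm_leftVec_apply_le (j : Idx a) :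
    ‖((ageValue a p lam j : ℝ) : 𝕜)‖ ≤ ‖h.leftVec‖ := by
  rw [RCLike.norm_ofReal]
  exact lp.norm_apply_le_norm (by simp) h.leftVec j

/-- The functional `u ↦ (u, v*)`. -/
def IsPersistence.leftCLM (𝕜 : Type) [RCLike 𝕜] : L1 𝕜 a →L[𝕜] 𝕜 :=
  l1Lift 𝕜 (fun j : Idx a => ((ageValue a p lam j : ℝ) : 𝕜)) ‖h.leftVec‖ h.norm_leftVec_apply_le

theorem IsPersistence.leftCLM_sub {B : L1 𝕜 a →L[𝕜] L1 𝕜 a} (hB : IsRenewalOp 𝕜 a p B)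
    (u : L1 𝕜 a) :
    h.leftCLM 𝕜 u - h.leftCLM 𝕜 (agingCLM p lam B u) = birthCLM 𝕜 a p lam u := by
  have : h.leftCLM 𝕜 - (h.leftCLM 𝕜).comp (agingCLM p lam B) = birthCLM 𝕜 a p lam :=
    clm_ext fun j => by
      have hb : ∀ j, h.leftCLM 𝕜 (basisVec 𝕜 j) = ((ageValue a p lam j : ℝ) : 𝕜) :=
        fun j => l1Lift_basisVec _ _ _ j
      change h.leftCLM 𝕜 (basisVec 𝕜 j) - h.leftCLM 𝕜 (agingCLM p lam B (basisVec 𝕜 j)) = _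
      rw [agingCLM_basisVec hB, map_smul, hb, hb, ageValue_fold, birthCLM_basisVec, h.ageValue_eq,
        fold_coe, smul_eq_mul, ← RCLike.ofReal_mul, ← RCLike.ofReal_sub, add_sub_cancel_right]
  exact congrArg (fun A => A u) this

theorem IsPersistence.leftCLM_toComplex (u : L1 ℝ a) :
    h.leftCLM ℂ (toComplex a u) = (pair u h.leftVec : ℂ) := by
  rw [pair, Complex.ofReal_tsum]
  exact tsum_congr fun k => (Complex.ofReal_mul _ _).symm

theorem IsPersistence.toComplex_rightVec :
    toComplex a (rightVec ℝ a p lam) = rightVec ℂ a p lam := by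
  have h1 := (h.hasSum_rightVec (𝕜 := ℝ)).mapL (toComplex a).toContinuousLinearMap
  refine h1.unique ((h.hasSum_rightVec (𝕜 := ℂ)).congr_fun fun n => ?_)
  change toComplex a _ = _
  rw [toComplex_smul, toComplex_basisVec]
  rfl

theorem IsPersistence.hasSum_rightVec_apply (k : Idx a) :
    HasSum (fun n => prodFrom (rat a p lam) 0 n * (if k = fold a n then 1 else 0))
      (rightVec ℝ a p lam k) := by
  have h1 := (h.hasSum_rightVec (𝕜 := ℝ)).mapL (lp.evalCLM ℝ (fun _ : Idx a => ℝ) 1 k)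
  refine h1.congr_fun fun n => ?_
  rw [map_smul]
  change _ = prodFrom (rat a p lam) 0 n * basisVec ℝ (fold a n) k
  rw [basisVec_apply]

theorem IsPersistence.pair_pos : 0 < pair (rightVec ℝ a p lam) h.leftVec := by
  have hterm : ∀ k n, 0 ≤ prodFrom (rat a p lam) 0 n * (if k = fold a n then 1 else 0) :=
    fun k n => mul_nonneg (prodFrom_nonneg h.rat_nonneg _ _) (by split_ifs <;> norm_num)
  have h0 : ∀ k, 0 ≤ rightVec ℝ a p lam k := fun k => (h.hasSum_rightVec_apply k).nonneg (hterm k)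
  refine (pair_summable _ _).tsum_pos (fun k => mul_nonneg (h0 k) (h.ageValue_nonneg k))
    (zeroIdx a) (mul_pos ?_ ?_)
  · have := le_hasSum (h.hasSum_rightVec_apply (zeroIdx a)) 0 fun n _ => hterm _ n
    rw [prodFrom_zero, fold_zero, if_pos rfl, one_mul] at this
    linarith
  · rw [h.leftVec_apply, zeroIdx, h.ageValue_zero]; exact one_pos

theorem IsPersistence.apply_rightVec {B : L1 𝕜 a →L[𝕜] L1 𝕜 a} (hB : IsRenewalOp 𝕜 a p B) :
    B (rightVec 𝕜 a p lam) = (lam : 𝕜) • rightVec 𝕜 a p lam := by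
  have hl : (lam : 𝕜) ≠ 0 := RCLike.ofReal_ne_zero.2 h.lam_pos.ne'
  have h1 := smul_eq_agingCLM_add (p := p) (lam := lam) B (rightVec 𝕜 a p lam)
  rw [h.birthCLM_rightVec, one_smul, ← h.rightVec_sub hB, add_sub_cancel] at h1
  have h2 : (lam : 𝕜)⁻¹ • B (rightVec 𝕜 a p lam) = rightVec 𝕜 a p lam := h1
  conv_rhs => rw [← h2]
  rw [smul_smul, mul_inv_cancel₀ hl, one_smul]

omit h in
theorem pair_basisVec (j : Idx a) (w : Linf a) : pair (basisVec ℝ j) w = w j := by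
  rw [pair, tsum_eq_single j fun k hk => by rw [basisVec_apply, if_neg hk, zero_mul],
    basisVec_apply, if_pos rfl, one_mul]

theorem IsPersistence.adj_leftVec {B : L1 ℝ a →L[ℝ] L1 ℝ a} (hB : IsRenewalOp ℝ a p B) :
    adj B h.leftVec = lam • h.leftVec := by
  ext j
  change pair (B (basisVec ℝ j)) h.leftVec = lam * h.leftVec j
  have h1 : ∀ u, pair u h.leftVec = pairCLM h.leftVec u := fun _ => rfl
  have hl := h.lam_pos.ne'
  rw [h1, hB, map_add, map_smul, map_smul, ← h1, ← h1, pair_basisVec, pair_basisVec,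
    h.leftVec_apply, h.leftVec_apply, h.leftVec_apply, ageValue_fold, zeroIdx, h.ageValue_zero,
    h.ageValue_eq j, fold_coe, rat]
  simp only [smul_eq_mul, RCLike.ofReal_real_eq_id, id_eq]
  field_simp

end Parts

/-! ### The gap for renewal operators and uniqueness of the eigenvectors. -/

section Gap

variable {a p lam : ℝ} (h : IsPersistence a p lam) {B : L1 ℝ a →L[ℝ] L1 ℝ a}
  {B' : L1 ℂ a →L[ℂ] L1 ℂ a}
include h

theorem IsPersistence.complex_gap (hB' : IsRenewalOp ℂ a p B') :
    (∀ μ ∈ spectrum ℂ ((lam : ℂ)⁻¹ • B'), μ ≠ 1 → ‖μ‖ < 1) ∧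
      ∃ C₁ > (0 : ℝ), ∃ γ₁ ∈ Set.Ioo (0 : ℝ) 1, ∀ (x : L1 ℂ a) (n : ℕ),
        ‖(((lam : ℂ)⁻¹ • B') ^ n) x - (h.leftCLM ℂ x / h.leftCLM ℂ (rightVec ℂ a p lam)) •
          rightVec ℂ a p lam‖ ≤ C₁ * γ₁ ^ n * ‖x‖ := by
  obtain ⟨C, γ, hγ, hC⟩ := h.exists_aging_decay hB'
  refine rankOne_perturbation_gap hγ.1.le hγ.2 hC (h.rightVec_sub hB') h.birthCLM_rightVec
    (h.leftCLM_sub hB') ?_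
    (β := fun n => p / lam * dlt a (fold a n) * prodFrom (rat a p lam) 0 n) (fun n => ?_)
    (fun n => ?_) h.hasSum ?_ (smul_eq_agingCLM_add B')
  · rw [← h.toComplex_rightVec, h.leftCLM_toComplex]
    exact Complex.ofReal_ne_zero.2 h.pair_pos.ne'
  · rw [agingCLM_pow_basisVec hB', map_smul, birthCLM_basisVec, zeroIdx, zero_add, smul_eq_mul,
      mul_comm]
    exact (Complex.ofReal_mul _ _).symm
  · have := h.ageTerm_nonneg 0 n
    rwa [ageTerm, zero_add] at this
  · rw [prodFrom_zero, dlt_fold (by simp), dlt_zero, mul_one, mul_one]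
    exact div_pos h.p_pos h.lam_pos

theorem IsPersistence.isLeadingEigenvalue (hB' : IsRenewalOp ℂ a p B') :
    IsLeadingEigenvalue B' lam := by
  have hl : (lam : ℂ) ≠ 0 := Complex.ofReal_ne_zero.2 h.lam_pos.ne'
  refine ⟨Module.End.hasEigenvalue_of_hasEigenvector (x := rightVec ℂ a p lam)
    ⟨Module.End.mem_eigenspace_iff.2 (h.apply_rightVec hB'), fun h0 => ?_⟩, fun μ hμ hne => ?_⟩
  · have := h.birthCLM_rightVec (𝕜 := ℂ)
    rw [h0, map_zero] at this
    exact zero_ne_one this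
  · have h1 : (lam : ℂ)⁻¹ * μ ∈ spectrum ℂ ((lam : ℂ)⁻¹ • B') := by
      have := (spectrum.smul_mem_smul_iff (r := (Units.mk0 (lam : ℂ) hl)⁻¹)).2 hμ
      exact this
    have h2 := (h.complex_gap hB').1 _ h1 fun h3 => hne (by field_simp at h3; exact h3)
    rwa [norm_mul, norm_inv, Complex.norm_real, Real.norm_of_nonneg h.lam_pos.le,
      inv_mul_lt_one₀ h.lam_pos] at h2

theorem IsPersistence.hasSpectralGap (hB : IsRenewalOp ℝ a p B) (hB' : IsRenewalOp ℂ a p B') :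
    HasSpectralGap B lam (rightVec ℝ a p lam) h.leftVec := by
  obtain ⟨C, hC, γ, hγ, hb⟩ := (h.complex_gap hB').2
  refine ⟨C, hC, γ, hγ, fun u n => ?_⟩
  have hpow : (B' ^ n) (toComplex a u) = toComplex a ((B ^ n) u) := by
    induction n with
    | zero => rfl
    | succ n ih =>
      have h1 : (B' ^ (n + 1)) (toComplex a u) = B' ((B' ^ n) (toComplex a u)) := by
        rw [pow_succ']; rfl
      have h2 : (B ^ (n + 1)) u = B ((B ^ n) u) := by rw [pow_succ']; rfl
      rw [h1, h2, ih, toComplex_comm hB hB']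
  have h1 := hb (toComplex a u) n
  have h2 : (((lam : ℂ)⁻¹ • B') ^ n) (toComplex a u) = toComplex a ((lam ^ n)⁻¹ • (B ^ n) u) := by
    rw [smul_pow, toComplex_smul, ← hpow]
    push_cast
    rw [← inv_pow]
    rfl
  rw [h2, ← h.toComplex_rightVec, h.leftCLM_toComplex, h.leftCLM_toComplex, ← Complex.ofReal_div,
    ← toComplex_smul, ← map_sub, (toComplex a).norm_map, (toComplex a).norm_map] at h1
  exact h1

/-- Uniqueness is read off the gap: an eigenvector is fixed by `λ^{-n} B^n`, hence equals the limit,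
a multiple of `v`. The adjoint case pairs the same limit with `w`. -/
theorem IsPersistence.isTheEigenvector (hB : IsRenewalOp ℝ a p B) (hB' : IsRenewalOp ℂ a p B') :
    IsTheEigenvector B lam (rightVec ℝ a p lam) := by
  obtain ⟨C, hC, γ, hγ, hb⟩ := h.hasSpectralGap hB hB'
  refine ⟨fun h0 => ?_, le_antisymm (fun u hu => ?_) ?_⟩
  · have := h.pair_pos
    rw [h0] at this
    simp [pair] at this
  · have hu' : B u = lam • u := Module.End.mem_eigenspace_iff.1 hu
    have hpow : ∀ n : ℕ, (lam ^ n)⁻¹ • (B ^ n) u = u := fun n => by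
      have h1 : (B ^ n) u = lam ^ n • u := by
        induction n with
        | zero => simp
        | succ n ih =>
          have h1 : (B ^ (n + 1)) u = B ((B ^ n) u) := by rw [pow_succ']; rfl
          rw [h1, ih, map_smul, hu', smul_smul, pow_succ]
      rw [h1, smul_smul, inv_mul_cancel₀ (pow_pos h.lam_pos n).ne', one_smul]
    have hlim : Tendsto (fun n : ℕ => C * γ ^ n * ‖u‖) atTop (𝓝 0) := by
      simpa using ((tendsto_pow_atTop_nhds_zero_of_lt_one hγ.1.le hγ.2).const_mul C).mul_const ‖u‖
    have h2 := ge_of_tendsto' hlim fun n => by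
      have := hb u n
      rwa [hpow] at this
    have h3 := sub_eq_zero.1 (norm_le_zero_iff.1 h2)
    rw [h3]
    exact Submodule.smul_mem _ _ (Submodule.mem_span_singleton_self _)
  · rw [Submodule.span_singleton_le_iff_mem]
    exact Module.End.mem_eigenspace_iff.2 (h.apply_rightVec hB)

theorem IsPersistence.isTheEigenvector_adj (hB : IsRenewalOp ℝ a p B)
    (hB' : IsRenewalOp ℂ a p B') : IsTheEigenvector (adj B) lam h.leftVec := by
  obtain ⟨C, hC, γ, hγ, hb⟩ := h.hasSpectralGap hB hB'
  refine ⟨fun h0 => ?_, le_antisymm (fun w hw => ?_) ?_⟩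
  · have := h.pair_pos
    rw [h0] at this
    simp [pair] at this
  · have hw' : adj B w = lam • w := Module.End.mem_eigenspace_iff.1 hw
    have hsmul : ∀ (c : ℝ) u, pair (c • u) w = c * pair u w := fun c u =>
      map_smul (pairCLM w) c u
    have hpow : ∀ (u : L1 ℝ a) (n : ℕ), pair ((B ^ n) u) w = lam ^ n * pair u w := by
      intro u n
      induction n with
      | zero => simp
      | succ n ih =>
        have h1 : (B ^ (n + 1)) u = B ((B ^ n) u) := by rw [pow_succ']; rfl
        have h2 : ∀ x : L1 ℝ a, pair x (lam • w) = lam * pair x w := fun x => by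
          simp only [pair, ← tsum_mul_left]
          exact tsum_congr fun k => by
            rw [lp.coeFn_smul, Pi.smul_apply, smul_eq_mul]; ring
        rw [h1, pair_adj, hw', h2, ih, pow_succ]; ring
    have hval : ∀ u, pair u w = pair (rightVec ℝ a p lam) w / pair (rightVec ℝ a p lam) h.leftVec *
        pair u h.leftVec := by
      intro u
      have hlim : Tendsto (fun n : ℕ => ‖w‖ * (C * γ ^ n * ‖u‖)) atTop (𝓝 0) := by
        simpa using (((tendsto_pow_atTop_nhds_zero_of_lt_one hγ.1.le hγ.2).const_mul C).mul_const
          ‖u‖).const_mul ‖w‖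
      have h2 : |pair u w - (pair u h.leftVec / pair (rightVec ℝ a p lam) h.leftVec) *
          pair (rightVec ℝ a p lam) w| ≤ 0 := ge_of_tendsto' hlim fun n => by
        have h3 := (abs_pair_le ((lam ^ n)⁻¹ • (B ^ n) u - (pair u h.leftVec /
          pair (rightVec ℝ a p lam) h.leftVec) • rightVec ℝ a p lam) w).trans
          (mul_le_mul_of_nonneg_left (hb u n) (norm_nonneg w))
        have h4 : ∀ x y : L1 ℝ a, pair (x - y) w = pair x w - pair y w := fun x y =>
          map_sub (pairCLM w) x y
        rwa [h4, hsmul, hsmul, hpow, ← mul_assoc,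
          inv_mul_cancel₀ (pow_pos h.lam_pos n).ne', one_mul] at h3
      have h3 := sub_eq_zero.1 (abs_nonpos_iff.1 h2)
      rw [h3]; ring
    refine Submodule.mem_span_singleton.2
      ⟨pair (rightVec ℝ a p lam) w / pair (rightVec ℝ a p lam) h.leftVec, ?_⟩
    ext k
    rw [lp.coeFn_smul, Pi.smul_apply, smul_eq_mul, ← pair_basisVec k w, hval (basisVec ℝ k),
      pair_basisVec]
  · rw [Submodule.span_singleton_le_iff_mem]
    exact Module.End.mem_eigenspace_iff.2 (h.adj_leftVec hB)

end Gap

/-! ### Step functions with jumps on the orbit of zero -/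

theorem norm_step_le {a : ℝ} (y : ℝ) (j : Idx a) : ‖if orb a j ≤ y then (1 : ℝ) else 0‖ ≤ 1 := by
  split_ifs <;> simp

/-- The value at `y` of the step function `∑ u_j 1{T_a^j(0) ≤ ·}`. -/
def stepCLM (a y : ℝ) : L1 ℝ a →L[ℝ] ℝ :=
  l1Lift ℝ (fun j : Idx a => if orb a j ≤ y then (1 : ℝ) else 0) 1 (norm_step_le y)

theorem stepCLM_basisVec {a : ℝ} (y : ℝ) (j : Idx a) :
    stepCLM a y (basisVec ℝ j) = if orb a j ≤ y then 1 else 0 := l1Lift_basisVec _ _ _ j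

theorem hasSum_stepCLM {a : ℝ} (y : ℝ) (u : L1 ℝ a) :
    HasSum (fun j => u j * if orb a j ≤ y then 1 else 0) (stepCLM a y u) := by
  have h := (hasSum_basisVec u).mapL (stepCLM a y)
  simpa only [map_smul, smul_eq_mul, stepCLM_basisVec] using h

/-- The step function with the jumps `u_j` at the points `T_a^j(0)`. -/
def stepMap (a : ℝ) : L1 ℝ a →ₗ[ℝ] (State a → ℝ) where
  toFun u x := stepCLM a x u
  map_add' u w := by ext x; exact map_add _ _ _
  map_smul' c u := by ext x; exact map_smul _ _ _

theorem stepMap_apply {a : ℝ} (u : L1 ℝ a) (x : State a) : stepMap a u x = stepCLM a x u := rfl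

theorem stepMap_mem (a : ℝ) (u : L1 ℝ a) : stepMap a u ∈ U a := by
  let g : Idx a → {k : ℕ // (k : ℕ∞) ≤ kap a} := fun j => ⟨j, j.le_kap⟩
  have hg : Function.Injective g := fun i j h => Subtype.ext (congrArg (fun k => k.1) h)
  refine ⟨Function.extend g u 0, ?_, fun x => ?_⟩
  · refine (hg.summable_iff fun k hk => ?_).1 ?_
    · rw [Function.extend_apply' _ _ _ fun h => hk h]; simp
    · have := L1.summable_norm u
      refine this.congr fun j => ?_
      simp [hg.extend_apply]
  · refine (HasSum.tsum_eq ((hg.hasSum_iff fun k hk => ?_).1 ?_)).symm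
    · rw [Function.extend_apply' _ _ _ fun h => hk h]; simp
    · refine (hasSum_stepCLM x.1 u).congr_fun fun j => ?_
      simp [hg.extend_apply, g]

/-- In the periodic case an element of `U` has many representations; folding adds up the
coefficients that sit at the same point. -/
theorem exists_stepMap_eq {a : ℝ} {f : State a → ℝ} (hf : f ∈ U a) : ∃ u, stepMap a u = f := by
  obtain ⟨w, hw, hf⟩ := hf
  have hs : Summable fun k : {k : ℕ // (k : ℕ∞) ≤ kap a} => w k • basisVec ℝ (fold a k) := by
    refine Summable.of_norm_bounded hw fun k => ?_
    rw [norm_smul, norm_basisVec, mul_one, Real.norm_eq_abs]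
  refine ⟨∑' k, w k • basisVec ℝ (fold a k), funext fun x => ?_⟩
  rw [stepMap_apply, hf, (stepCLM a x).map_tsum hs]
  refine tsum_congr fun k => ?_
  rw [map_smul, stepCLM_basisVec, orb_fold k.2, smul_eq_mul]

/-! ### Jumps, total variation and the isometry. -/

section Jumps

variable {a : ℝ} (ha : 1 / 2 < a) (ha' : a ≤ 2 / 3)
include ha ha'

theorem orb_nonneg (j : Idx a) : 0 ≤ orb a j := (orb_mem_Icc ha ha' j.le_kap).1

theorem orb_pos {j : Idx a} (hj : j ≠ zeroIdx a) : 0 < orb a j :=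
  lt_of_le_of_ne (orb_nonneg ha ha' j) fun h => hj (orb_injective h.symm)

theorem extZero_stepMap (u : L1 ℝ a) {y : ℝ} (hy : y ≤ 1 / (1 - a)) :
    extZero (stepMap a u) y = stepCLM a y u := by
  unfold extZero
  split_ifs with h
  · rfl
  · have hy0 : y < 0 := not_le.1 fun h0 => h ⟨h0, hy⟩
    refine HasSum.unique ?_ (hasSum_stepCLM y u)
    refine hasSum_zero.congr_fun fun j => ?_
    rw [if_neg (not_le.2 (hy0.trans_le (orb_nonneg ha ha' j))), mul_zero]

omit ha ha' in
theorem tendsto_stepCLM (u : L1 ℝ a) (k : Idx a) :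
    Tendsto (fun z => stepCLM a z u) (𝓝[<] orb a k) (𝓝 (stepCLM a (orb a k) u - u k)) := by
  have h1 : HasSum (fun j => u j * if orb a j < orb a k then 1 else 0)
      (stepCLM a (orb a k) u - u k) := by
    have hk : HasSum (fun j => if j = k then u k else 0) (u k) := hasSum_ite_eq k (u k)
    refine ((hasSum_stepCLM (orb a k) u).sub hk).congr_fun fun j => ?_
    by_cases hjk : j = k
    · simp [hjk]
    · have hne : orb a j ≠ orb a k := fun h => hjk (orb_injective h)
      rcases lt_or_gt_of_ne hne with h | h
      · simp [h, h.le, hjk]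
      · simp [not_lt.2 h.le, not_le.2 h, hjk]
  rw [← h1.tsum_eq]
  have h2 : (fun z => stepCLM a z u) = fun z => ∑' j, u j * if orb a j ≤ z then 1 else 0 :=
    funext fun z => (hasSum_stepCLM z u).tsum_eq.symm
  rw [h2]
  refine tendsto_tsum_of_dominated_convergence (L1.summable_norm u) (fun j => ?_)
    (Eventually.of_forall fun z j => ?_)
  · refine Tendsto.const_mul _ (tendsto_const_nhds.congr' ?_)
    split_ifs with h
    · filter_upwards [Ioo_mem_nhdsLT h] with z hz
      rw [if_pos hz.1.le]
    · filter_upwards [self_mem_nhdsWithin] with z hz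
      rw [if_neg (not_le.2 (lt_of_lt_of_le hz (not_lt.1 h)))]
  · rw [norm_mul]
    exact mul_le_of_le_one_right (norm_nonneg _) (norm_step_le z j)

theorem isJump_stepMap (u : L1 ℝ a) (k : Idx a) : IsJump (stepMap a u) (orb a k) (u k) := by
  have hle := (orb_mem_Icc ha ha' k.le_kap).2
  rw [IsJump, extZero_stepMap ha ha' u hle]
  refine (tendsto_stepCLM u k).congr' ?_
  filter_upwards [self_mem_nhdsWithin] with z hz
  rw [extZero_stepMap ha ha' u ((le_of_lt hz).trans hle)]

theorem stepCLM_zero (u : L1 ℝ a) : stepCLM a 0 u = u (zeroIdx a) := by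
  refine (hasSum_stepCLM 0 u).unique ?_
  have h := hasSum_ite_eq (zeroIdx a) (u (zeroIdx a))
  refine h.congr_fun fun j => ?_
  by_cases hj : j = zeroIdx a
  · simp [hj, zeroIdx, orb_zero]
  · simp [hj, orb_pos ha ha' hj]

omit ha ha' in
/-- The absolute values of the coordinates. -/
def absVec (u : L1 ℝ a) : L1 ℝ a :=
  ⟨fun k => |u k|, memℓp_gen (by simpa using L1.summable_norm u)⟩

omit ha ha' in
theorem abs_stepCLM_sub_le (u : L1 ℝ a) {x y : ℝ} (hxy : x ≤ y) :
    |stepCLM a y u - stepCLM a x u| ≤ stepCLM a y (absVec u) - stepCLM a x (absVec u) := by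
  have h1 := (hasSum_stepCLM y u).sub (hasSum_stepCLM x u)
  have h2 := (hasSum_stepCLM y (absVec u)).sub (hasSum_stepCLM x (absVec u))
  rw [← h1.tsum_eq, ← Real.norm_eq_abs]
  refine tsum_of_norm_bounded h2 fun j => ?_
  change |_| ≤ |u j| * _ - |u j| * _
  rw [← mul_sub, ← mul_sub, abs_mul]
  refine mul_le_mul_of_nonneg_left (le_of_eq (abs_of_nonneg ?_)) (abs_nonneg _)
  by_cases hx : orb a j ≤ x
  · simp [hx, hx.trans hxy]
  · rw [if_neg hx, sub_zero]; split_ifs <;> norm_num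

omit ha ha' in
theorem stepCLM_absVec_le (u : L1 ℝ a) (y : ℝ) : stepCLM a y (absVec u) ≤ ‖u‖ := by
  rw [L1.norm_eq]
  refine hasSum_le (fun j => ?_) (hasSum_stepCLM y (absVec u)) (L1.summable_norm u).hasSum
  exact mul_le_of_le_one_right (abs_nonneg _) (by split_ifs <;> norm_num)

/-- The step function of `|u|` is nondecreasing and dominates every increment, so sums of increments
telescope. It is at least `|u_0|` throughout, since the jump at `0` lies at the left endpoint and is
not seen by the variation. -/
theorem eVariationOn_stepMap_le (u : L1 ℝ a) :
    eVariationOn (stepMap a u) Set.univ ≤ ENNReal.ofReal (‖u‖ - |u (zeroIdx a)|) := by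
  have hz : ∀ x : State a, |u (zeroIdx a)| ≤ stepCLM a x (absVec u) := fun x => by
    have h0 := stepCLM_zero ha ha' (absVec u)
    have h1 := (abs_nonneg _).trans (abs_stepCLM_sub_le u x.2.1)
    change stepCLM a 0 (absVec u) = |u (zeroIdx a)| at h0
    linarith
  refine iSup_le fun ⟨n, t, ht, _⟩ => ?_
  have h1 : ∀ i, edist (stepMap a u (t (i + 1))) (stepMap a u (t i)) ≤
      ENNReal.ofReal (stepCLM a (t (i + 1)) (absVec u) - stepCLM a (t i) (absVec u)) := fun i => by
    rw [edist_dist, Real.dist_eq]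
    exact ENNReal.ofReal_le_ofReal (abs_stepCLM_sub_le u (ht (Nat.le_succ i)))
  refine (Finset.sum_le_sum fun i _ => h1 i).trans ?_
  rw [← ENNReal.ofReal_sum_of_nonneg fun i _ =>
    (abs_nonneg _).trans (abs_stepCLM_sub_le u (ht (Nat.le_succ i))),
    Finset.sum_range_sub fun i => stepCLM a (t i) (absVec u)]
  exact ENNReal.ofReal_le_ofReal (sub_le_sub (stepCLM_absVec_le u _) (hz _))

/-- The rightmost jump is peeled off: a point `z` just to its left separates it from the other
points of the finite set, variation adds over the two sides of `z`, and `z` tends to the jump. -/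
theorem sum_jumps_le_eVariationOn (u : L1 ℝ a) (s : Finset (Idx a)) (hs : zeroIdx a ∉ s)
    (b : State a) (hb : ∀ j ∈ s, orb a j ≤ b) :
    ENNReal.ofReal (∑ j ∈ s, |u j|) ≤ eVariationOn (stepMap a u) {x | x ≤ b} := by
  induction s using Finset.induction_on_max_value (fun j : Idx a => orb a j) generalizing b with
  | empty => simp
  | insert m s hm hmax ih =>
    have hm0 : m ≠ zeroIdx a := fun h => hs (h ▸ Finset.mem_insert_self m s)
    have hs' : zeroIdx a ∉ s := fun h => hs (Finset.mem_insert_of_mem h)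
    have hlt : ∀ j ∈ s, orb a j < orb a m := fun j hj =>
      lt_of_le_of_ne (hmax j hj) fun h => hm (orb_injective h ▸ hj)
    have hmem := orb_mem_Icc ha ha' m.le_kap
    have hmb : orb a m ≤ b := hb m (Finset.mem_insert_self m s)
    have hlim : Tendsto (fun z => ENNReal.ofReal (∑ j ∈ s, |u j|
        + |stepCLM a (orb a m) u - stepCLM a z u|)) (𝓝[<] orb a m)
        (𝓝 (ENNReal.ofReal (∑ j ∈ s, |u j| + |u m|))) := by
      refine ENNReal.tendsto_ofReal (Tendsto.const_add _ ?_)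
      have := ((tendsto_stepCLM u m).const_sub (stepCLM a (orb a m) u)).abs
      rwa [sub_sub_cancel] at this
    rw [Finset.sum_insert hm, add_comm]
    refine le_of_tendsto hlim ?_
    have hev : ∀ᶠ z in 𝓝[<] orb a m, ∀ j ∈ s, orb a j < z :=
      (eventually_all_finset s).2 fun j hj => by
        filter_upwards [Ioo_mem_nhdsLT (hlt j hj)] with z hz using hz.1
    filter_upwards [hev, Ioo_mem_nhdsLT (orb_pos ha ha' hm0)] with z hz hz'
    let t : State a := ⟨z, hz'.1.le, hz'.2.le.trans hmem.2⟩
    let y : State a := ⟨orb a m, hmem⟩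
    rw [ENNReal.ofReal_add (Finset.sum_nonneg fun j _ => abs_nonneg _) (abs_nonneg _)]
    have h1 := ih hs' t fun j hj => (hz j hj).le
    have h2 : ENNReal.ofReal |stepCLM a (orb a m) u - stepCLM a z u| ≤
        eVariationOn (stepMap a u) {x | t ≤ x ∧ x ≤ b} := by
      rw [← Real.dist_eq, ← edist_dist]
      exact eVariationOn.edist_le (stepMap a u) (x := y) (y := t)
        ⟨hz'.2.le, hmb⟩ ⟨le_rfl, hz'.2.le.trans hmb⟩
    refine (add_le_add h1 h2).trans ((eVariationOn.add_le_union _ ?_).trans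
      (eVariationOn.mono _ ?_))
    · exact fun x hx w hw => le_trans hx hw.1
    · rintro x (hx | hx)
      · exact le_trans hx (hz'.2.le.trans hmb)
      · exact hx.2

theorem boundedVariationOn_stepMap (u : L1 ℝ a) : BoundedVariationOn (stepMap a u) Set.univ :=
  ((eVariationOn_stepMap_le ha ha' u).trans_lt ENNReal.ofReal_lt_top).ne

theorem bvNorm_stepMap (u : L1 ℝ a) : bvNorm (stepMap a u) = ‖u‖ := by
  have h1a : 0 < 1 - a := by linarith
  have hz : |u (zeroIdx a)| ≤ ‖u‖ := lp.norm_apply_le_norm (by simp) u (zeroIdx a)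
  rw [bvNorm, extZero_stepMap ha ha' u (by positivity), stepCLM_zero ha ha']
  refine le_antisymm ?_ ?_
  · have := ENNReal.toReal_mono ENNReal.ofReal_ne_top (eVariationOn_stepMap_le ha ha' u)
    rw [ENNReal.toReal_ofReal (by linarith)] at this
    linarith
  · rw [L1.norm_eq]
    refine Real.tsum_le_of_sum_le (fun _ => norm_nonneg _) fun s => ?_
    classical
    let b : State a := ⟨1 / (1 - a), by positivity, le_rfl⟩
    have h1 := sum_jumps_le_eVariationOn ha ha' u (s.erase (zeroIdx a)) (by simp) b fun j _ =>
      (orb_mem_Icc ha ha' j.le_kap).2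
    have h2 := ENNReal.toReal_mono (boundedVariationOn_stepMap ha ha' u)
      (h1.trans (eVariationOn.mono _ (Set.subset_univ _)))
    rw [ENNReal.toReal_ofReal (Finset.sum_nonneg fun _ _ => abs_nonneg _)] at h2
    have h3 : ∑ j ∈ s, ‖u j‖ ≤ ∑ j ∈ insert (zeroIdx a) (s.erase (zeroIdx a)), ‖u j‖ := by
      refine Finset.sum_le_sum_of_subset_of_nonneg (fun j hj => ?_) fun _ _ _ => norm_nonneg _
      by_cases h : j = zeroIdx a <;> simp [h, hj]
    rw [Finset.sum_insert (by simp)] at h3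
    exact h3.trans (add_le_add le_rfl h2)

/-- The linear bijection `u ↦ ∑ u_j 1{T_a^j(0) ≤ ·}` onto `U`. -/
def stepEquiv : L1 ℝ a ≃ₗ[ℝ] U a :=
  LinearEquiv.ofBijective ((stepMap a).codRestrict (U a) (stepMap_mem a)) ⟨by
    refine (injective_iff_map_eq_zero _).2 fun u hu => ?_
    have h : stepMap a u = stepMap a 0 := by
      rw [map_zero]; exact congrArg Subtype.val hu
    rw [← norm_eq_zero, ← bvNorm_stepMap ha ha', h, bvNorm_stepMap ha ha', norm_zero], fun f => by
    obtain ⟨u, hu⟩ := exists_stepMap_eq f.2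
    exact ⟨u, Subtype.ext hu⟩⟩

theorem stepEquiv_coe (u : L1 ℝ a) : (stepEquiv ha ha' u : State a → ℝ) = stepMap a u := rfl

/-! ### The killed chain acting on step functions -/

/-- The action of `P` on one step. If `T^j(0) < 1`, the up-jump always clears the threshold and
gives a step at zero, and the down-jump gives a step at the next orbit point. If `T^j(0) ≥ 1`, the
down-jump never clears it and the up-jump moves the step. -/
theorem killed_step {p : ℝ} (x : State a) (j : Idx a) :
    p * (if orb a j ≤ a * x + 1 then 1 else 0) + (1 - p) * (if orb a j ≤ a * x - 1 then 1 else 0) =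
      p * dlt a j + cz a p j * (if orb a (fold a (j + 1)) ≤ x then 1 else 0) := by
  have h0 : 0 < a := by linarith
  have h1 : 0 < 1 - a := by linarith
  have hx0 : 0 ≤ a * x.1 := mul_nonneg h0.le x.2.1
  have hx1 : a * x.1 ≤ a / (1 - a) := by
    have := mul_le_mul_of_nonneg_left x.2.2 h0.le
    rwa [mul_one_div] at this
  have hsub : a / (1 - a) - 1 = (2 * a - 1) / (1 - a) := by field_simp; ring
  rcases lt_or_ge (orb a j) 1 with hj | hj
  · have hd : dlt a j = 1 := if_pos hj
    rw [hd, if_pos (show orb a j ≤ a * x + 1 by linarith)]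
    rcases lt_or_ge (j.1 : ℕ∞) (kap a) with hk | hk
    · have hle : ((j.1 + 1 : ℕ) : ℕ∞) ≤ kap a := by exact_mod_cast Order.add_one_le_of_lt hk
      rw [cz_of_lt hk, orb_fold hle, orb_succ, T_of_lt hj, cf, hd]
      have : (orb a j + 1) / a ≤ x ↔ orb a j ≤ a * x - 1 := by
        rw [div_le_iff₀ h0]; constructor <;> intro h <;> linarith
      simp only [this]
      ring
    · have hmem : orb a j ∈ hole a := by
        rcases kap_cases a with ⟨h, -⟩ | ⟨K, hK, hmem, -⟩
        · rw [h] at hk; simp at hk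
        · have : j.1 = K := by
            have := le_antisymm j.le_kap hk
            rw [hK] at this
            exact_mod_cast this
          rwa [this]
      -- A down-jump lands at most at `(2a-1)/(1-a)`, the left end of the hole, so it never passes a
      -- point of the hole.
      rw [cz_of_le hk, if_neg (show ¬ orb a j ≤ a * x - 1 by linarith [hmem.1])]
      ring
  · have hd : dlt a j = 0 := if_neg (not_lt.2 hj)
    have hk : (j.1 : ℕ∞) < kap a := by
      refine lt_of_le_of_ne j.le_kap fun h => ?_
      rcases kap_cases a with ⟨h', -⟩ | ⟨K, hK, hmem, -⟩
      · rw [h'] at h; simp at h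
      · have : j.1 = K := by rw [hK] at h; exact_mod_cast h
        rw [← this] at hmem
        exact absurd hmem.2 (not_lt.2 hj)
    have hle : ((j.1 + 1 : ℕ) : ℕ∞) ≤ kap a := by exact_mod_cast Order.add_one_le_of_lt hk
    -- The bound `(2a-1)/(1-a)` on down-jumps is below `1` except for `a = 2/3`, where it equals `1`
    -- and the orbit avoids that value.
    have hlt : a * x.1 - 1 < orb a j := by
      rcases ha'.lt_or_eq with hlt | rfl
      · have : (2 * a - 1) / (1 - a) < 1 := by rw [div_lt_one h1]; linarith
        linarith
      · have h2 : orb (2 / 3) j ≠ 1 := orb_two_thirds_ne_one j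
        have h3 := lt_of_le_of_ne hj h2.symm
        norm_num at hx1
        linarith
    rw [hd, if_neg (not_le.2 hlt), cz_of_lt hk, orb_fold hle, orb_succ, T_of_ge hj, cf, hd]
    have : (orb a j - 1) / a ≤ x ↔ orb a j ≤ a * x + 1 := by
      rw [div_le_iff₀ h0]; constructor <;> intro h <;> linarith
    simp only [this]
    ring

theorem killed_stepMap {p : ℝ} (hp : 0 < p) (hp' : p < 1) {B : L1 ℝ a →L[ℝ] L1 ℝ a}
    (hB : IsRenewalOp ℝ a p B) (u : L1 ℝ a) :
    killed a p (stepMap a u) = stepMap a (B u) := by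
  funext x
  have h0 : 0 < a := by linarith
  have h1 : 0 < 1 - a := by linarith
  have hx1 : a * x.1 ≤ a / (1 - a) := by
    have := mul_le_mul_of_nonneg_left x.2.2 h0.le
    rwa [mul_one_div] at this
  have hsub : 1 / (1 - a) = a / (1 - a) + 1 := by field_simp; ring
  have hclm : p • stepCLM a (a * x + 1) + (1 - p) • stepCLM a (a * x - 1) =
      (stepCLM a x).comp B := clm_ext fun j => by
    change p * stepCLM a (a * x + 1) (basisVec ℝ j) + (1 - p) * stepCLM a (a * x - 1) (basisVec ℝ j)
      = stepCLM a x (B (basisVec ℝ j))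
    rw [hB, map_add, map_smul, map_smul]
    simp only [stepCLM_basisVec, smul_eq_mul, RCLike.ofReal_real_eq_id, id_eq]
    rw [killed_step ha ha' x j, if_pos (show orb a (zeroIdx a) ≤ x.1 from x.2.1), mul_one]
  change killedFun a p (stepMap a u) x = _
  rw [killedFun_apply, ENNReal.toReal_ofReal hp.le, ENNReal.toReal_ofReal (by linarith),
    extZero_stepMap ha ha' u (by linarith), extZero_stepMap ha ha' u (by linarith)]
  exact congrArg (fun A => A u) hclm

end Jumps

/-! ### Irreducibility -/

theorem toMat_apply {a p : ℝ} {B : L1 ℝ a →L[ℝ] L1 ℝ a} (hB : IsRenewalOp ℝ a p B)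
    (i j : Idx a) : toMat B i j = (if i.1 = 0 then p * dlt a j else 0)
      + if i.1 = (fold a (j + 1)).1 then cz a p j else 0 := by
  have h := renewal_rhs_apply (𝕜 := ℝ) (p := p) j i
  rw [← hB] at h
  exact h

theorem isIrreducible_toMat {a p : ℝ} (ha : 1 / 2 < a) (ha' : a ≤ 2 / 3) (hp : 0 < p) (hp' : p < 1)
    {B : L1 ℝ a →L[ℝ] L1 ℝ a} (hB : IsRenewalOp ℝ a p B) (hk : kap a = ⊤)
    (hR : ∀ k, orb a k ≠ 1 / (1 - a)) : (toMat B).IsIrreducible := by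
  have h1 : ∀ i j : Idx a, 0 ≤ (if i.1 = 0 then p * dlt a j else 0) := fun i j => by
    split_ifs
    · exact mul_nonneg hp.le (dlt_nonneg _ _)
    · exact le_rfl
  have h2 : ∀ i j : Idx a, 0 ≤ if i.1 = (fold a (j + 1)).1 then cz a p j else 0 := fun i j => by
    split_ifs
    · exact cz_nonneg hp hp' _
    · exact le_rfl
  refine ⟨fun i j => ?_, ?_⟩
  · rw [toMat_apply hB]; exact add_nonneg (h1 i j) (h2 i j)
  -- A positive entry `(i, j)` is an arrow from `i` to `j`, although it means that `j` feeds `i`; so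
  -- paths run backwards in age.
  · let : Quiver (Idx a) := Matrix.toQuiver (toMat B)
    have hage : ∀ k, 0 < toMat B (fold a (k + 1)) (fold a k) := fun k => by
      rw [toMat_apply hB]
      refine add_pos_of_nonneg_of_pos (h1 _ _) ?_
      rw [fold_fold_add_one, if_pos rfl, cz_of_lt (by simp [hk])]
      exact cf_pos hp hp' _
    have hpath : ∀ n k, Nonempty (Quiver.Path (fold a (k + n)) (fold a k)) := by
      intro n
      induction n with
      | zero => exact fun k => ⟨Quiver.Path.nil⟩
      | succ n ih =>
        intro k
        obtain ⟨q⟩ := ih k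
        exact ⟨(Quiver.Hom.toPath (PLift.up (hage (k + n)))).comp q⟩
    -- From `i` back to age zero, from there to some age `j + n` with its orbit point below `1` (a
    -- birth), and back to `j`. The birth arrow makes the length positive, and the hypothesis on the
    -- fixed point ensures that such an age exists.
    intro i j
    obtain ⟨m, hm, hm'⟩ := exists_orb_lt_one ha ha' hk (hR j)
    obtain ⟨n, rfl⟩ := Nat.exists_eq_add_of_le hm
    have hbirth : 0 < toMat B (zeroIdx a) (fold a (j.1 + n)) := by
      rw [toMat_apply hB]
      refine add_pos_of_pos_of_nonneg ?_ (h2 _ _)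
      rw [if_pos (show (zeroIdx a).1 = 0 from rfl), dlt_fold (by simp [hk]), dlt, if_pos hm',
        mul_one]
      exact hp
    obtain ⟨q1⟩ := hpath i.1 0
    obtain ⟨q2⟩ := hpath n j.1
    rw [zero_add, fold_coe, fold_zero] at q1
    rw [fold_coe] at q2
    refine ⟨(q1.cons (PLift.up hbirth)).comp q2, ?_⟩
    rw [Quiver.Path.length_comp, Quiver.Path.length_cons]
    omega

/-! ### The eigenvectors in the coordinates of the orbit -/

section Coordinates

variable {a p lam : ℝ} (h : IsPersistence a p lam)
include h

/-- For an aperiodic orbit each index receives exactly one term of the Neumann series; under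
periodicity several terms merge, which is why `MV` replaces `v`. -/
theorem IsPersistence.rightVec_apply (hap : Aperiodic a) (k : Idx a) :
    rightVec ℝ a p lam k = vCoord a p lam k := by
  refine (h.hasSum_rightVec_apply k).unique ?_
  rw [← prodFrom_rat_eq_vCoord h.p_pos k.le_kap]
  convert hasSum_single k.1 (fun n hn => ?_) using 1
  · rw [fold_coe, if_pos rfl, mul_one]
  · rcases le_or_gt (n : ℕ∞) (kap a) with hle | hlt
    · have hf : fold a n = ⟨n, hle.trans hap.le⟩ := fold_eq_of_orb_eq hle rfl
      rw [hf, if_neg (fun h => hn (congrArg Subtype.val h).symm), mul_zero]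
    · rw [prodFrom_rat_eq_zero hlt, zero_mul]

theorem IsPersistence.isV_stepMap : IsV a p lam (stepMap a (rightVec ℝ a p lam)) := by
  intro x
  have h1 := (h.hasSum_rightVec (𝕜 := ℝ)).mapL (stepCLM a x)
  rw [← (Subtype.val_injective (p := fun k : ℕ => (k : ℕ∞) ≤ kap a)).hasSum_iff] at h1
  · refine h1.congr_fun fun k => ?_
    rw [Function.comp_apply, map_smul, stepCLM_basisVec, orb_fold k.2,
      prodFrom_rat_eq_vCoord h.p_pos k.2]
    rfl
  · intro n hn
    have hlt : kap a < n := not_le.1 fun hle => hn ⟨⟨n, hle⟩, rfl⟩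
    rw [prodFrom_rat_eq_zero hlt]
    simp

end Coordinates

end KilledAR

end

/-! ### Assembly of the two cases. -/

theorem proposition2 (a p : ℝ) (ha : 1 / 2 < a) (ha' : a ≤ 2 / 3) (hp : 0 < p) (hp' : p < 1) :
    ∃ lam : ℝ,
      -- `lam` is the unique positive solution of the characteristic equation, and `lam > p`
      (p < lam ∧ CharEq a p lam ∧ ∀ μ : ℝ, 0 < μ → CharEq a p μ → μ = lam) ∧
      -- the isometry `M` and the invariance of `U` under `P`
      ∃ (M : U a ≃ₗ[ℝ] L1 ℝ a) (hP : ∀ f ∈ U a, killed a p f ∈ U a),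
        (∀ (f : U a) (k : Idx a), IsJump f.1 (orb a k) (M f k)) ∧
        (∀ f : U a, BoundedVariationOn f.1 Set.univ ∧ ‖M f‖ = bvNorm f.1) ∧
        -- the aperiodic case
        (Aperiodic a →
          (∀ f : U a, (killed a p).restrict hP f = M.symm (opA ℝ a p (M f))) ∧
          IsLeadingEigenvalue (opA ℂ a p) lam ∧
          ∃ (v : L1 ℝ a) (vs : Linf a),
            (∀ k : Idx a, v k = vCoord a p lam k) ∧
            (∀ k : Idx a, IsVStarCoord a p lam k (vs k)) ∧
            IsTheEigenvector (opA ℝ a p) lam v ∧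
            IsTheEigenvector (adj (opA ℝ a p)) lam vs ∧
            0 < pair v vs ∧
            HasSpectralGap (opA ℝ a p) lam v vs) ∧
        -- the eventually periodic case
        (EventuallyPeriodic a →
          (∀ f : U a, (killed a p).restrict hP f = M.symm (opAhat ℝ a p (M f))) ∧
          ((∀ k : ℕ, orb a k ≠ 1 / (1 - a)) → (toMat (opAhat ℝ a p)).IsIrreducible) ∧
          IsLeadingEigenvalue (opAhat ℂ a p) lam ∧
          ∃ (V : U a) (vs : Linf a),
            IsV a p lam V.1 ∧
            (∀ k : Idx a, IsVStarCoord a p lam k (vs k)) ∧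
            IsTheEigenvector (opAhat ℝ a p) lam (M V) ∧
            IsTheEigenvector (adj (opAhat ℝ a p)) lam vs ∧
            0 < pair (M V) vs ∧
            HasSpectralGap (opAhat ℝ a p) lam (M V) vs) := by

  obtain ⟨lam, h, hchar, huniq⟩ := exists_persistence ha ha' hp hp'
  have hmap : ∀ {B : L1 ℝ a →L[ℝ] L1 ℝ a}, IsRenewalOp ℝ a p B → ∀ f : U a,
      killed a p f = stepEquiv ha ha' (B ((stepEquiv ha ha').symm f)) := fun {B} hB f => by
    rw [stepEquiv_coe, ← killed_stepMap ha ha' hp hp' hB, ← stepEquiv_coe ha ha',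
      LinearEquiv.apply_symm_apply]
  have hP : ∀ f ∈ U a, killed a p f ∈ U a := fun f hf => by
    -- Every orbit is aperiodic or eventually periodic, so one of `A` and `Â` always represents `P`;
    -- this gives the invariance of `U` with no case assumption.
    obtain ⟨B, hB⟩ : ∃ B, IsRenewalOp ℝ a p B := by
      rcases (kap'_structure a).1 with hk | hk
      · exact ⟨_, isRenewalOp_opA hk⟩
      · by_cases hk' : kap' a = ⊤
        · exact ⟨_, isRenewalOp_opA (hk.trans hk'.symm)⟩
        · exact ⟨_, isRenewalOp_opAhat ⟨Ne.lt_top hk', hk⟩⟩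
    rw [hmap hB ⟨f, hf⟩]
    exact Subtype.prop _
  have hstep : ∀ f : U a, (f : State a → ℝ) = stepMap a ((stepEquiv ha ha').symm f) := fun f => by
    rw [← stepEquiv_coe ha ha', LinearEquiv.apply_symm_apply]
  refine ⟨lam, ⟨h.p_lt, hchar, huniq⟩, (stepEquiv ha ha').symm, hP, fun f k => ?_, fun f => ?_,
    fun hap => ?_, fun hper => ?_⟩
  · have := isJump_stepMap ha ha' ((stepEquiv ha ha').symm f) k
    rwa [← hstep] at this
  · have h1 := boundedVariationOn_stepMap ha ha' ((stepEquiv ha ha').symm f)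
    have h2 := bvNorm_stepMap ha ha' ((stepEquiv ha ha').symm f)
    rw [← hstep] at h1 h2
    exact ⟨h1, h2.symm⟩
  · have hB := isRenewalOp_opA (𝕜 := ℝ) (p := p) hap
    have hB' := isRenewalOp_opA (𝕜 := ℂ) (p := p) hap
    exact ⟨fun f => Subtype.ext (hmap hB f), h.isLeadingEigenvalue hB', rightVec ℝ a p lam,
      h.leftVec, h.rightVec_apply hap, fun k => h.isVStarCoord k.le_kap,
      h.isTheEigenvector hB hB', h.isTheEigenvector_adj hB hB', h.pair_pos,
      h.hasSpectralGap hB hB'⟩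
  · have hB := isRenewalOp_opAhat (𝕜 := ℝ) (p := p) hper
    have hB' := isRenewalOp_opAhat (𝕜 := ℂ) (p := p) hper
    refine ⟨fun f => Subtype.ext (hmap hB f),
      fun hR => isIrreducible_toMat ha ha' hp hp' hB hper.2 hR, h.isLeadingEigenvalue hB',
      stepEquiv ha ha' (rightVec ℝ a p lam), h.leftVec, h.isV_stepMap,
      fun k => h.isVStarCoord k.le_kap, ?_⟩
    rw [LinearEquiv.symm_apply_apply]
    exact ⟨h.isTheEigenvector hB hB', h.isTheEigenvector_adj hB hB', h.pair_pos,
      h.hasSpectralGap hB hB'⟩
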